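/- Let $T>0$. For $y_d\in L^2(0,1)$ consider the problem (P): minimize $\frac12\|y(T,\cdot)-y_d\|_{L^2(0,1)}^2$ over all $u\in L^2(0,T)$ with $-1\le u\le 1$ a.e. in $(0,T)$ and $y\in L^2(0,T;H^1(0,1))\cap H^1(0,T;H^1(0,1)^*)$ such that $y$ is the weak solution of $$\partial_t y-\partial_x^2 y=0 \text{ in } (0,T)\times(0,1),\quad \partial_x y(\cdot,0)=0,\quad \partial_x y(\cdot,1)=u,\quad y(0,\cdot)=0 .$$ Then there exists $y_d\in L^2(0,1)$ such that the optimal objective function value of (P) is positive and the following holds. Problem (P) has exactly one optimal control $\bar u$, with state $\bar y$, and there is exactly one weak solution $\bar p\in L^2(0,T;H^1(0,1))\cap H^1(0,T;H^1(0,1)^*)$ of the adjoint equation $$-\partial_t \bar p-\partial_x^2 \bar p=0 \text{ in } (0,T)\times(0,1),\quad \partial_x \bar p(\cdot,0)=\partial_x\bar p(\cdot,1)=0,\quad \bar p(T,\cdot)=\bar y(T,\cdot)-y_d .$$ The trace $\bar p(\cdot,1)$ is (a.e. equal to) a real analytic function on $[0,T)$, and this function changes infinitely often from positive to negative values and back,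 that is, there are $0\le s_0<s_1<s_2<\dots<T$ with $\bar p(s_k,1)>0$ for even $k$ and $\bar p(s_k,1)<0$ for odd $k$. The control satisfies $\bar u=-\operatorname{sgn}(\bar p(\cdot,1))$ a.e. in $(0,T)$ and has a right-continuous representative $\bar u\colon[0,T)\to\{-1,1\}$. For every $\varepsilon>0$ this representative has only finitely many switching points (points of discontinuity) in $(0,T)\cap[0,T-\varepsilon]$, and it has infinitely many switching points in $(0,T)$; that is, $\bar u$ is chattering. -/

import Mathlib

open Set MeasureTheory Filter Topology
open scoped ContDiff

namespace HeatControl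

noncomputable section

/-! ### Spaces -/

/-- The Lebesgue space `L²(0,1)`. -/
abbrev L2 : Type := Lp ℝ 2 (volume.restrict (Ioo (0 : ℝ) 1))

/-- The Lebesgue-Bochner space `L²(0,T;X)`. -/
abbrev L2T (T : ℝ) (X : Type) [NormedAddCommGroup X] : Type :=
  Lp X 2 (volume.restrict (Ioo (0 : ℝ) T))

/-- `φ ∈ C_c^∞(a,b)`. -/
structure IsTest (a b : ℝ) (φ : ℝ → ℝ) : Prop where
  smooth : ContDiff ℝ ∞ φ
  compact : HasCompactSupport φ
  support : tsupport φ ⊆ Ioo a b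

/-- `g` is the weak derivative of `f` on `(0,1)`. -/
def IsWeakDeriv (f g : L2) : Prop :=
  ∀ φ : ℝ → ℝ, IsTest 0 1 φ →
    ∫ x in Ioo (0 : ℝ) 1, f x * deriv φ x = - ∫ x in Ioo (0 : ℝ) 1, g x * φ x

lemma integrable_mul_of_test (f : L2) {φ : ℝ → ℝ} (h : Continuous φ)
    (hc : HasCompactSupport φ) :
    Integrable (fun x => f x * φ x) (volume.restrict (Ioo (0 : ℝ) 1)) := by
  have h1 : MemLp φ 2 (volume.restrict (Ioo (0 : ℝ) 1)) :=
    (h.memLp_of_hasCompactSupport hc).restrict _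
  exact (Lp.memLp f).integrable_mul h1

/-- The Sobolev space `H¹(0,1)`: pairs `(v, ∂ₓv)` in `L²(0,1) × L²(0,1)`, where `∂ₓv` is the weak
derivative of `v`, with the inner product `(v,w) + (∂ₓv,∂ₓw)`. -/
def H1Submodule : Submodule ℝ (WithLp 2 (L2 × L2)) where
  carrier := {w | IsWeakDeriv w.fst w.snd}
  zero_mem' := by
    intro φ _
    have h : ∀ ψ : ℝ → ℝ, ∫ x in Ioo (0 : ℝ) 1, (0 : L2) x * ψ x = 0 := by
      intro ψ
      have h0 : (fun x => (0 : L2) x * ψ x) =ᵐ[volume.restrict (Ioo (0 : ℝ) 1)] 0 := by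
        filter_upwards [Lp.coeFn_zero ℝ 2 (volume.restrict (Ioo (0 : ℝ) 1))] with x hx
        rw [hx]
        simp
      exact integral_eq_zero_of_ae h0
    simp only [WithLp.zero_fst, WithLp.zero_snd]
    rw [h, h, neg_zero]
  add_mem' := by
    intro a b ha hb φ hφ
    have hd : Continuous (deriv φ) := hφ.smooth.continuous_deriv (by simp)
    have key : ∀ (f g : L2) (ψ : ℝ → ℝ), Continuous ψ → HasCompactSupport ψ →
        ∫ x in Ioo (0 : ℝ) 1, (f + g) x * ψ x
          = (∫ x in Ioo (0 : ℝ) 1, f x * ψ x) + ∫ x in Ioo (0 : ℝ) 1, g x * ψ x := by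
      intro f g ψ h1 h2
      rw [← integral_add (integrable_mul_of_test f h1 h2) (integrable_mul_of_test g h1 h2)]
      apply integral_congr_ae
      filter_upwards [Lp.coeFn_add f g] with x hx
      rw [hx, Pi.add_apply, add_mul]
    have e1 := ha φ hφ
    have e2 := hb φ hφ
    simp only [WithLp.add_fst, WithLp.add_snd]
    rw [key _ _ _ hd hφ.compact.deriv, key _ _ _ hφ.smooth.continuous hφ.compact, e1, e2]
    ring
  smul_mem' := by
    intro c a ha φ hφ
    have key : ∀ (f : L2) (ψ : ℝ → ℝ),
        ∫ x in Ioo (0 : ℝ) 1, (c • f) x * ψ x = c * ∫ x in Ioo (0 : ℝ) 1, f x * ψ x := by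
      intro f ψ
      rw [← integral_const_mul]
      apply integral_congr_ae
      filter_upwards [Lp.coeFn_smul c f] with x hx
      rw [hx, Pi.smul_apply, smul_eq_mul, mul_assoc]
    have e1 := ha φ hφ
    simp only [WithLp.smul_fst, WithLp.smul_snd]
    rw [key, key, e1]
    ring

/-- The Sobolev space `H¹(0,1)`. -/
abbrev H1 : Type := H1Submodule

/-- The dual space `H¹(0,1)*`. -/
abbrev H1Dual : Type := StrongDual ℝ H1

/-- The embedding `H¹(0,1) → L²(0,1)`. -/
def toL2 : H1 →L[ℝ] L2 := (WithLp.fstL 2 ℝ L2 L2).comp H1Submodule.subtypeL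

/-- The weak spatial derivative `∂ₓ : H¹(0,1) → L²(0,1)`. -/
def dx : H1 →L[ℝ] L2 := (WithLp.sndL 2 ℝ L2 L2).comp H1Submodule.subtypeL

/-- The embedding `H¹(0,1) → L²(0,1) → H¹(0,1)*` of the Gelfand triple, `v ↦ (v, ·)`. -/
def toDual (v : H1) : H1Dual := (innerSL ℝ (toL2 v)).comp toL2

/-! ### Spatial traces -/

/-- A smooth compactly supported function on `(0,1)` with mean zero is the derivative of another. -/
lemma exists_primitive_of_test {χ : ℝ → ℝ} (hχ : IsTest 0 1 χ) (h0 : ∫ x, χ x = 0) :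
    ∃ Φ : ℝ → ℝ, IsTest 0 1 Φ ∧ deriv Φ = χ := by
  have hc : Continuous χ := hχ.smooth.continuous
  have hK : IsCompact (tsupport χ) := hχ.compact
  obtain ⟨a, b, ha, hb, hab⟩ : ∃ a b : ℝ, 0 < a ∧ b < 1 ∧ tsupport χ ⊆ Icc a b := by
    rcases (tsupport χ).eq_empty_or_nonempty with he | hne
    · exact ⟨1 / 2, 1 / 2, by norm_num, by norm_num, by simp [he]⟩
    · exact ⟨sInf (tsupport χ), sSup (tsupport χ), (hχ.support (hK.sInf_mem hne)).1,
        (hχ.support (hK.sSup_mem hne)).2, subset_Icc_csInf_csSup hK.bddBelow hK.bddAbove⟩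
  have hz : ∀ x, x ∉ Icc a b → χ x = 0 := fun x hx =>
    image_eq_zero_of_notMem_tsupport fun h => hx (hab h)
  have hd : ∀ x, HasDerivAt (fun x => ∫ t in (0 : ℝ)..x, χ t) (χ x) x := fun x =>
    intervalIntegral.integral_hasDerivAt_right (hc.intervalIntegrable _ _)
      (hc.stronglyMeasurableAtFilter _ _) hc.continuousAt
  have hd' : deriv (fun x => ∫ t in (0 : ℝ)..x, χ t) = χ := funext fun x => (hd x).deriv
  have hs : tsupport (fun x => ∫ t in (0 : ℝ)..x, χ t) ⊆ Icc a b := by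
    apply closure_minimal _ isClosed_Icc
    intro x hx
    by_contra hxn
    apply hx
    rw [mem_Icc, not_and_or, not_le, not_le] at hxn
    rcases hxn with hxa | hxb
    · apply intervalIntegral.integral_zero_ae
      filter_upwards with t ht
      apply hz
      intro hta
      have := ht.2
      rcases le_max_iff.1 this with h | h <;> linarith [hta.1]
    · beta_reduce
      rw [intervalIntegral.integral_eq_integral_of_support_subset, h0]
      intro t ht
      have : t ∈ Icc a b := by
        by_contra hn
        exact ht (hz t hn)
      exact ⟨by linarith [this.1], by linarith [this.2]⟩
  refine ⟨_, ⟨?_, ?_, ?_⟩, hd'⟩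
  · rw [contDiff_infty_iff_deriv]
    exact ⟨fun x => (hd x).differentiableAt, by rw [hd']; exact hχ.smooth⟩
  · exact isCompact_Icc.of_isClosed_subset (isClosed_tsupport _) hs
  · exact fun x hx => ⟨by linarith [(hs hx).1], by linarith [(hs hx).2]⟩

/-- An integrable function on `(0,1)` with zero weak derivative is constant. -/
lemma ae_const_of_weakDeriv_zero {h : ℝ → ℝ} (hi : IntegrableOn h (Ioo 0 1))
    (hw : ∀ φ, IsTest 0 1 φ → ∫ x in Ioo (0 : ℝ) 1, h x * deriv φ x = 0) :
    ∃ c : ℝ, ∀ᵐ x ∂(volume.restrict (Ioo (0 : ℝ) 1)), h x = c := by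
  have hmul : ∀ ψ, IsTest 0 1 ψ → IntegrableOn (fun x => h x * ψ x) (Ioo 0 1) := by
    intro ψ hψ
    obtain ⟨C, hC⟩ := hψ.smooth.continuous.bounded_above_of_compact_support hψ.compact
    exact hi.mul_bdd hψ.smooth.continuous.aestronglyMeasurable (ae_of_all _ hC)
  have hset : ∀ ψ, IsTest 0 1 ψ → ∫ x in Ioo (0 : ℝ) 1, ψ x = ∫ x, ψ x := by
    intro ψ hψ
    apply setIntegral_eq_integral_of_forall_compl_eq_zero
    intro x hx
    exact image_eq_zero_of_notMem_tsupport fun hh => hx (hψ.support hh)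
  let B : ContDiffBump (1 / 2 : ℝ) := ⟨1 / 8, 1 / 4, by norm_num, by norm_num⟩
  have hρ : IsTest 0 1 (B.normed volume) := by
    refine ⟨B.contDiff_normed, B.hasCompactSupport_normed, ?_⟩
    rw [B.tsupport_normed_eq, Real.closedBall_eq_Icc]
    intro x hx
    have h1 := hx.1
    have h2 := hx.2
    simp only [B] at h1 h2
    constructor <;> linarith
  have hρ1 : ∫ x, B.normed volume x = 1 := B.integral_normed
  set ρ := B.normed volume
  set c := ∫ x in Ioo (0 : ℝ) 1, h x * ρ x with hc
  refine ⟨c, ?_⟩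
  have hic : IntegrableOn (fun x => h x - c) (Ioo 0 1) := hi.sub (by simp)
  have main := isOpen_Ioo.ae_eq_zero_of_integral_contDiff_smul_eq_zero (μ := volume)
    (f := fun x => h x - c) hic.locallyIntegrableOn ?_
  · rw [ae_restrict_iff' measurableSet_Ioo]
    filter_upwards [main] with x hx hxm
    linarith [hx hxm]
  intro ψ h1 h2 h3
  have hψ : IsTest 0 1 ψ := ⟨h1, h2, h3⟩
  set I := ∫ x, ψ x with hI
  have hχ : IsTest 0 1 (fun x => ψ x - I * ρ x) := by
    refine ⟨h1.sub (contDiff_const.mul hρ.smooth), ?_, ?_⟩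
    · exact h2.sub hρ.compact.mul_left
    · refine (tsupport_sub _ _).trans (union_subset h3 ?_)
      exact (closure_mono (Function.support_mul_subset_right _ _)).trans hρ.support
  have hχ0 : ∫ x, (ψ x - I * ρ x) = 0 := by
    rw [integral_sub (h1.continuous.integrable_of_hasCompactSupport h2)
      ((hρ.smooth.continuous.integrable_of_hasCompactSupport hρ.compact).const_mul I),
      integral_const_mul, hρ1, mul_one, sub_self]
  obtain ⟨Φ, hΦ, hΦ'⟩ := exists_primitive_of_test hχ hχ0
  have e := hw Φ hΦ
  rw [hΦ'] at e
  have e2 : ∫ x in Ioo (0 : ℝ) 1, h x * (ψ x - I * ρ x)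
      = (∫ x in Ioo (0 : ℝ) 1, h x * ψ x) - I * c := by
    rw [hc, ← integral_const_mul, ← integral_sub (hmul ψ hψ) ((hmul ρ hρ).const_mul I)]
    congr 1
    ext x
    ring
  have e3 : ∫ x, ψ x • (h x - c) = ∫ x in Ioo (0 : ℝ) 1, ψ x • (h x - c) := by
    symm
    apply setIntegral_eq_integral_of_forall_compl_eq_zero
    intro x hx
    rw [image_eq_zero_of_notMem_tsupport fun hh => hx (h3 hh), zero_smul]
  have e4 : ∫ x in Ioo (0 : ℝ) 1, ψ x • (h x - c)
      = (∫ x in Ioo (0 : ℝ) 1, h x * ψ x) - c * I := by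
    rw [hI, ← hset ψ hψ, ← integral_const_mul, ← integral_sub (hmul ψ hψ)
      ((h1.continuous.integrable_of_hasCompactSupport h2).integrableOn.const_mul c)]
    congr 1
    ext x
    rw [smul_eq_mul]
    ring
  rw [e3, e4]
  linarith

/-- Every element of `H¹(0,1)` has a representative that is continuous on `[0,1]`. -/
lemma exists_continuous_rep (v : H1) :
    ∃ f : ℝ → ℝ, ContinuousOn f (Icc 0 1) ∧
      ∀ᵐ x ∂(volume.restrict (Ioo (0 : ℝ) 1)), toL2 v x = f x := by
  have hv : IsWeakDeriv (toL2 v) (dx v) := v.2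
  set g := dx v
  set f := toL2 v
  have hg : IntegrableOn g (Ioo 0 1) := (Lp.memLp g).integrable (by norm_num)
  have hf : IntegrableOn f (Ioo 0 1) := (Lp.memLp f).integrable (by norm_num)
  have hgi : IntervalIntegrable g volume 0 1 := by
    rw [intervalIntegrable_iff_integrableOn_Ioo_of_le zero_le_one]
    exact hg
  set G : ℝ → ℝ := fun x => ∫ t in (0 : ℝ)..x, g t with hG
  have hGac : AbsolutelyContinuousOnInterval G 0 1 :=
    hgi.absolutelyContinuousOnInterval_intervalIntegral (by simp)
  have hGc : ContinuousOn G (Icc 0 1) := by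
    simpa [uIcc_of_le] using hGac.continuousOn
  have hGi : IntegrableOn G (Ioo 0 1) :=
    (hGc.integrableOn_compact isCompact_Icc).mono_set Ioo_subset_Icc_self
  have hGd : ∀ᵐ x ∂(volume.restrict (Ioo (0 : ℝ) 1)), deriv G x = g x := by
    rw [ae_restrict_iff' measurableSet_Ioo]
    filter_upwards [hgi.ae_hasDerivAt_integral] with x hx hxm
    rw [uIcc_of_le zero_le_one] at hx
    exact (hx (Ioo_subset_Icc_self hxm) 0 (by simp)).deriv
  have hconv : ∀ k : ℝ → ℝ, ∫ x in (0 : ℝ)..1, k x = ∫ x in Ioo (0 : ℝ) 1, k x := fun k => by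
    rw [intervalIntegral.integral_of_le zero_le_one, integral_Ioc_eq_integral_Ioo]
  obtain ⟨c, hc⟩ := ae_const_of_weakDeriv_zero (h := fun x => f x - G x) (hf.sub hGi) (by
    intro φ hφ
    have z0 : φ 0 = 0 := image_eq_zero_of_notMem_tsupport fun h => by
      simpa using (hφ.support h).1
    have z1 : φ 1 = 0 := image_eq_zero_of_notMem_tsupport fun h => by
      simpa using (hφ.support h).2
    have hparts := hGac.integral_mul_deriv_eq_deriv_mul
      ((hφ.smooth.of_le (by simp)).contDiffOn.absolutelyContinuousOnInterval (a := 0) (b := 1))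
    rw [z0, z1, hconv, hconv] at hparts
    have hcg : ∫ x in Ioo (0 : ℝ) 1, deriv G x * φ x = ∫ x in Ioo (0 : ℝ) 1, g x * φ x := by
      apply integral_congr_ae
      filter_upwards [hGd] with x hx
      rw [hx]
    have hd : Continuous (deriv φ) := hφ.smooth.continuous_deriv (by simp)
    obtain ⟨C, hC⟩ := hd.bounded_above_of_compact_support hφ.compact.deriv
    have e := hv φ hφ
    simp only [sub_mul]
    rw [integral_sub (hf.mul_bdd hd.aestronglyMeasurable (ae_of_all _ hC))
      (hGi.mul_bdd hd.aestronglyMeasurable (ae_of_all _ hC)), e, hparts, hcg]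
    ring)
  refine ⟨fun x => G x + c, hGc.add continuousOn_const, ?_⟩
  filter_upwards [hc] with x hx
  linarith

/-- The representative of `v ∈ H¹(0,1)` that is continuous on `[0,1]`. -/
def contRep (v : H1) : ℝ → ℝ := (exists_continuous_rep v).choose

/-- The trace `v(1)` of `v ∈ H¹(0,1)`. -/
def traceOne (v : H1) : ℝ := contRep v 1

/-! ### The space `L²(0,T;H¹(0,1)) ∩ H¹(0,T;H¹(0,1)*)` -/

/-- `g ∈ L²(0,T;H¹(0,1)*)` is the weak time derivative `∂ₜy` of `y ∈ L²(0,T;H¹(0,1))`. -/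
def IsTimeDeriv (T : ℝ) (y : L2T T H1) (g : L2T T H1Dual) : Prop :=
  ∀ φ : ℝ → ℝ, IsTest 0 T φ →
    ∫ t in Ioo (0 : ℝ) T, deriv φ t • toDual (y t) = - ∫ t in Ioo (0 : ℝ) T, φ t • g t

/-- `y(t₀,·) = z`: the representative of `y` in `C([0,T];L²(0,1))` takes the value `z` at `t₀`. -/
def HasTimeTrace (T : ℝ) (y : L2T T H1) (t₀ : ℝ) (z : L2) : Prop :=
  ∃ Y : ℝ → L2, ContinuousOn Y (Icc 0 T) ∧
    (∀ᵐ t ∂(volume.restrict (Ioo (0 : ℝ) T)), Y t = toL2 (y t)) ∧ Y t₀ = z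

/-! ### The optimal control problem -/

/-- `y` is the weak solution of `∂ₜy - ∂ₓ²y = 0` in `(0,T) × (0,1)`, `∂ₓy(·,0) = 0`,
`∂ₓy(·,1) = u`, `y(0,·) = 0`. -/
def IsState (T : ℝ) (u : L2T T ℝ) (y : L2T T H1) : Prop :=
  (∃ g : L2T T H1Dual, IsTimeDeriv T y g ∧
    ∀ᵐ t ∂(volume.restrict (Ioo (0 : ℝ) T)), ∀ v : H1,
      g t v + inner ℝ (dx (y t)) (dx v) = u t * traceOne v) ∧
  HasTimeTrace T y 0 0

/-- `p` is the weak solution of `-∂ₜp - ∂ₓ²p = 0` in `(0,T) × (0,1)`,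
`∂ₓp(·,0) = ∂ₓp(·,1) = 0`, `p(T,·) = w`. -/
def IsAdjointState (T : ℝ) (w : L2) (p : L2T T H1) : Prop :=
  (∃ g : L2T T H1Dual, IsTimeDeriv T p g ∧
    ∀ᵐ t ∂(volume.restrict (Ioo (0 : ℝ) T)), ∀ v : H1,
      - g t v + inner ℝ (dx (p t)) (dx v) = 0) ∧
  HasTimeTrace T p T w

/-- `-1 ≤ u ≤ 1` a.e. in `(0,T)`. -/
def AdmissibleControl (T : ℝ) (u : L2T T ℝ) : Prop :=
  ∀ᵐ t ∂(volume.restrict (Ioo (0 : ℝ) T)), -1 ≤ u t ∧ u t ≤ 1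

/-- The set of all values `½ ‖y(T,·) - y_d‖²` of the objective at feasible pairs `(u,y)`. -/
def objectiveValues (T : ℝ) (yd : L2) : Set ℝ :=
  {j | ∃ (u : L2T T ℝ) (y : L2T T H1) (yT : L2), AdmissibleControl T u ∧ IsState T u y ∧
    HasTimeTrace T y T yT ∧ j = 1 / 2 * ‖yT - yd‖ ^ 2}

/-- The optimal objective function value. -/
def optimalValue (T : ℝ) (yd : L2) : ℝ := sInf (objectiveValues T yd)

/-- The feasible pair `(u,y)` with terminal state `y(T,·) = yT` is optimal. -/
structure IsOptimal (T : ℝ) (yd : L2) (u : L2T T ℝ) (y : L2T T H1) (yT : L2) : Prop where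
  admissible : AdmissibleControl T u
  state : IsState T u y
  terminal : HasTimeTrace T y T yT
  minimal : ∀ j ∈ objectiveValues T yd, 1 / 2 * ‖yT - yd‖ ^ 2 ≤ j

/-! ### Switching -/

/-- `θ` changes infinitely often from positive to negative values and back on `[0,T)`. -/
def ChangesSignInfinitelyOften (T : ℝ) (θ : ℝ → ℝ) : Prop :=
  ∃ s : ℕ → ℝ, StrictMono s ∧ (∀ k, s k ∈ Ico 0 T) ∧
    ∀ k, 0 < θ (s (2 * k)) ∧ θ (s (2 * k + 1)) < 0

/-- The points of `(0,T)` at which the function `U : [0,T) → {-1,1}` switches its value. -/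
def switchingPoints (T : ℝ) (U : ℝ → ℝ) : Set ℝ := {t ∈ Ioo 0 T | ¬ ContinuousAt U t}

end

end HeatControl

open HeatControl

namespace HeatControl

noncomputable section

/-! ### Integration by parts in `H¹(0,1)` -/

/-! The problem is built backward: the adjoint terminal value `w` is chosen first, and the desired
state is fitted to it. For any `w`, let `theta T w` be the trace at `x = 1` of the adjoint state
with terminal value `w`. Let `u = -sgn (theta T w)`, let `yT` be the terminal state of `u`, and put
`yd = yT - w`. Then `yT - yd = w`, so the adjoint state of the problem is the prescribed one.

Duality gives `(w, zT) = ∫ theta T w * v` for the terminal state `zT` of every admissible `v`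
(`inner_terminal_eq`). Hence `(w, zT - yT) ≥ 0`, and expanding `‖zT - yd‖² = ‖w‖² + 2 (w, zT - yT) +
‖zT - yT‖²` shows that `u` is optimal with value `‖w‖² / 2`. If `theta T w` vanishes only on a null
set, equality forces `v = u` (`inner_sub_nonneg`), so the optimal control is unique.

It remains to find `w` whose trace takes both signs arbitrarily close to `T`, which is a Baire
category argument (`exists_oscillating`). Otherwise `L²(0,1)` is a countable union of closed sets of
those `w` whose trace has a fixed weak sign on some `(a, T)`, and one of these sets contains a ball.
The functional `w ↦ theta T w t` is the inner product with a kernel whose norm tends to infinity as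
`t → T`, because boundary evaluation is unbounded on `L²`. The ball also contains, near its center,
a finite cosine sum, whose trace stays bounded. Moving from that sum by a fixed small length against
the kernel gives the wrong sign for `t` near `T` (`interior_sign_eq_empty`).

The trace is a series of decaying exponentials and is therefore analytic before `T`
(`analyticOnNhd_theta`). Its zeros are finite in number on each `[0, T - ε]`, while the oscillation
makes the sign change infinitely often.

All of this rests on the Neumann cosine basis of `L²(0,1)`, which is also orthogonal and total in
`H¹(0,1)`. It turns the weak heat equation into independent scalar equations solved by variation of
constants. This gives uniqueness, existence and the series for the trace. -/

lemma integral_Ioo_eq {a b : ℝ} (hab : a ≤ b) (k : ℝ → ℝ) :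
    ∫ x in Ioo a b, k x = ∫ x in a..b, k x := by
  rw [intervalIntegral.integral_of_le hab, integral_Ioc_eq_integral_Ioo]

lemma integrable_of_Lp {a b : ℝ} {X : Type} [NormedAddCommGroup X]
    (f : Lp X 2 (volume.restrict (Ioo a b))) : IntegrableOn f (Ioo a b) :=
  (Lp.memLp f).integrable (by norm_num)

/-- A weakly differentiable function is a constant plus the primitive of its weak derivative. -/
lemma exists_primitive_rep (v : H1) :
    ∃ c : ℝ, ∀ᵐ x ∂(volume.restrict (Ioo (0 : ℝ) 1)),
      toL2 v x = (∫ t in (0 : ℝ)..x, dx v t) + c := by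
  have hv : IsWeakDeriv (toL2 v) (dx v) := v.2
  set g := dx v
  set f := toL2 v
  have hg : IntegrableOn g (Ioo 0 1) := integrable_of_Lp g
  have hf : IntegrableOn f (Ioo 0 1) := integrable_of_Lp f
  have hgi : IntervalIntegrable g volume 0 1 := by
    rw [intervalIntegrable_iff_integrableOn_Ioo_of_le zero_le_one]
    exact hg
  set G : ℝ → ℝ := fun x => ∫ t in (0 : ℝ)..x, g t with hG
  have hGac : AbsolutelyContinuousOnInterval G 0 1 :=
    hgi.absolutelyContinuousOnInterval_intervalIntegral (by simp)
  have hGc : ContinuousOn G (Icc 0 1) := by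
    simpa [uIcc_of_le] using hGac.continuousOn
  have hGi : IntegrableOn G (Ioo 0 1) :=
    (hGc.integrableOn_compact isCompact_Icc).mono_set Ioo_subset_Icc_self
  have hGd : ∀ᵐ x ∂(volume.restrict (Ioo (0 : ℝ) 1)), deriv G x = g x := by
    rw [ae_restrict_iff' measurableSet_Ioo]
    filter_upwards [hgi.ae_hasDerivAt_integral] with x hx hxm
    rw [uIcc_of_le zero_le_one] at hx
    exact (hx (Ioo_subset_Icc_self hxm) 0 (by simp)).deriv
  -- `G` is absolutely continuous with derivative `g`, so integration by parts makes `g` its weak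
  -- derivative as well, and `f - G` has weak derivative zero.
  obtain ⟨c, hc⟩ := ae_const_of_weakDeriv_zero (h := fun x => f x - G x) (hf.sub hGi) (by
    intro φ hφ
    have z0 : φ 0 = 0 := image_eq_zero_of_notMem_tsupport fun h => by
      simpa using (hφ.support h).1
    have z1 : φ 1 = 0 := image_eq_zero_of_notMem_tsupport fun h => by
      simpa using (hφ.support h).2
    have hparts := hGac.integral_mul_deriv_eq_deriv_mul
      ((hφ.smooth.of_le (by simp)).contDiffOn.absolutelyContinuousOnInterval (a := 0) (b := 1))
    rw [z0, z1, ← integral_Ioo_eq zero_le_one, ← integral_Ioo_eq zero_le_one] at hparts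
    have hcg : ∫ x in Ioo (0 : ℝ) 1, deriv G x * φ x = ∫ x in Ioo (0 : ℝ) 1, g x * φ x := by
      apply integral_congr_ae
      filter_upwards [hGd] with x hx
      rw [hx]
    have hd : Continuous (deriv φ) := hφ.smooth.continuous_deriv (by simp)
    obtain ⟨C, hC⟩ := hd.bounded_above_of_compact_support hφ.compact.deriv
    have e := hv φ hφ
    simp only [sub_mul]
    rw [integral_sub (hf.mul_bdd hd.aestronglyMeasurable (ae_of_all _ hC))
      (hGi.mul_bdd hd.aestronglyMeasurable (ae_of_all _ hC)), e, hparts, hcg]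
    ring)
  refine ⟨c, ?_⟩
  filter_upwards [hc] with x hx
  linarith

lemma contRep_continuousOn (v : H1) : ContinuousOn (contRep v) (Icc 0 1) :=
  (exists_continuous_rep v).choose_spec.1

lemma contRep_ae (v : H1) :
    ∀ᵐ x ∂(volume.restrict (Ioo (0 : ℝ) 1)), toL2 v x = contRep v x :=
  (exists_continuous_rep v).choose_spec.2

/-- Two functions continuous on `[a,b]` that agree a.e. on `(a,b)` agree on `[a,b]`. -/
lemma eqOn_Icc_of_ae_Ioo {X : Type} [TopologicalSpace X] [T2Space X] {a b : ℝ} (hab : a < b)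
    {f g : ℝ → X} (hf : ContinuousOn f (Icc a b)) (hg : ContinuousOn g (Icc a b))
    (h : ∀ᵐ x ∂(volume.restrict (Ioo a b)), f x = g x) : EqOn f g (Icc a b) := by
  apply Measure.eqOn_Icc_of_ae_eq volume hab.ne _ hf hg
  rw [← Measure.restrict_congr_set Ioo_ae_eq_Icc]
  exact h

/-- Here `ψ` need not vanish at the endpoints. The surviving boundary terms express the trace as a
bounded functional (`ψ = id`), and they drop out for derivatives of Neumann eigenfunctions. -/
lemma integral_mul_deriv (v : H1) {ψ : ℝ → ℝ} (hψ : ContDiff ℝ 1 ψ) :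
    ∫ x in Ioo (0 : ℝ) 1, toL2 v x * deriv ψ x
      = contRep v 1 * ψ 1 - contRep v 0 * ψ 0 - ∫ x in Ioo (0 : ℝ) 1, dx v x * ψ x := by
  obtain ⟨c, hc⟩ := exists_primitive_rep v
  set g := dx v
  have hgi : IntervalIntegrable g volume 0 1 := by
    rw [intervalIntegrable_iff_integrableOn_Ioo_of_le zero_le_one]
    exact integrable_of_Lp g
  set G : ℝ → ℝ := fun x => (∫ t in (0 : ℝ)..x, g t) + c with hG
  have hGac : AbsolutelyContinuousOnInterval G 0 1 :=
    (hgi.absolutelyContinuousOnInterval_intervalIntegral (by simp)).fun_add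
      (contDiff_const.contDiffOn (n := 1)).absolutelyContinuousOnInterval
  have hGc : ContinuousOn G (Icc 0 1) := by
    simpa [uIcc_of_le] using hGac.continuousOn
  have hGd : ∀ᵐ x ∂(volume.restrict (Ioo (0 : ℝ) 1)), deriv G x = g x := by
    rw [ae_restrict_iff' measurableSet_Ioo]
    filter_upwards [hgi.ae_hasDerivAt_integral] with x hx hxm
    rw [uIcc_of_le zero_le_one] at hx
    exact ((hx (Ioo_subset_Icc_self hxm) 0 (by simp)).add_const c).deriv
  -- `contRep` is only a chosen continuous representative; its endpoint values are pinned down by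
  -- almost everywhere equality and continuity up to the boundary.
  have hrep : EqOn (contRep v) G (Icc 0 1) := by
    apply eqOn_Icc_of_ae_Ioo zero_lt_one (contRep_continuousOn v) hGc
    filter_upwards [hc, contRep_ae v] with x h1 h2
    rw [← h2, h1]
  have hparts := hGac.integral_mul_deriv_eq_deriv_mul
    (hψ.contDiffOn.absolutelyContinuousOnInterval (a := 0) (b := 1))
  rw [← integral_Ioo_eq zero_le_one, ← integral_Ioo_eq zero_le_one] at hparts
  rw [hrep (by simp), hrep (by simp)]
  rw [integral_congr_ae (g := fun x => G x * deriv ψ x)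
    (by filter_upwards [hc] with x hx; rw [hx]), hparts]
  congr 1
  apply integral_congr_ae
  filter_upwards [hGd] with x hx
  rw [hx]

/-! ### Smooth functions as elements of `L²(0,1)` and `H¹(0,1)` -/

lemma memLp_of_continuous {a b : ℝ} {ψ : ℝ → ℝ} (h : Continuous ψ) :
    MemLp ψ 2 (volume.restrict (Ioo a b)) := by
  obtain ⟨C, hC⟩ := isCompact_Icc.exists_bound_of_continuousOn (s := Icc a b) h.continuousOn
  refine MemLp.of_bound h.aestronglyMeasurable C ?_
  rw [ae_restrict_iff' measurableSet_Ioo]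
  exact ae_of_all _ fun x hx => hC x (Ioo_subset_Icc_self hx)

/-- The class in `L²(0,1)` of a continuous function. -/
def ofCont (ψ : ℝ → ℝ) (h : Continuous ψ) : L2 := (memLp_of_continuous h).toLp ψ

lemma ofCont_ae (ψ : ℝ → ℝ) (h : Continuous ψ) :
    ∀ᵐ x ∂(volume.restrict (Ioo (0 : ℝ) 1)), ofCont ψ h x = ψ x :=
  (memLp_of_continuous h).coeFn_toLp

lemma inner_ofCont (f : L2) (ψ : ℝ → ℝ) (h : Continuous ψ) :
    inner ℝ f (ofCont ψ h) = ∫ x in Ioo (0 : ℝ) 1, f x * ψ x := by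
  rw [L2.inner_def]
  apply integral_congr_ae
  filter_upwards [ofCont_ae ψ h] with x hx
  rw [hx, real_inner_eq_re_inner, RCLike.inner_apply]
  simp [mul_comm]

/-- The class in `H¹(0,1)` of a `C¹` function. -/
def ofSmooth (ψ : ℝ → ℝ) (h : ContDiff ℝ 1 ψ) : H1 :=
  ⟨WithLp.toLp 2 (ofCont ψ h.continuous, ofCont (deriv ψ) (h.continuous_deriv le_rfl)), by
    intro φ hφ
    have z0 : φ 0 = 0 := image_eq_zero_of_notMem_tsupport fun h => by
      simpa using (hφ.support h).1
    have z1 : φ 1 = 0 := image_eq_zero_of_notMem_tsupport fun h => by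
      simpa using (hφ.support h).2
    have e := (h.contDiffOn.absolutelyContinuousOnInterval
      (a := 0) (b := 1)).integral_mul_deriv_eq_deriv_mul
      ((hφ.smooth.of_le (by simp)).contDiffOn.absolutelyContinuousOnInterval (a := 0) (b := 1))
    rw [z0, z1, ← integral_Ioo_eq zero_le_one, ← integral_Ioo_eq zero_le_one] at e
    calc ∫ x in Ioo (0 : ℝ) 1, ofCont ψ h.continuous x * deriv φ x
        = ∫ x in Ioo (0 : ℝ) 1, ψ x * deriv φ x := by
          apply integral_congr_ae
          filter_upwards [ofCont_ae ψ h.continuous] with x hx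
          rw [hx]
      _ = - ∫ x in Ioo (0 : ℝ) 1, deriv ψ x * φ x := by rw [e]; ring
      _ = _ := by
          congr 1
          apply integral_congr_ae
          filter_upwards [ofCont_ae (deriv ψ) (h.continuous_deriv le_rfl)] with x hx
          exact congrArg (· * φ x) hx.symm⟩

lemma toL2_ofSmooth (ψ : ℝ → ℝ) (h : ContDiff ℝ 1 ψ) :
    toL2 (ofSmooth ψ h) = ofCont ψ h.continuous := rfl

lemma dx_ofSmooth (ψ : ℝ → ℝ) (h : ContDiff ℝ 1 ψ) :
    dx (ofSmooth ψ h) = ofCont (deriv ψ) (h.continuous_deriv le_rfl) := rfl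

lemma traceOne_ofSmooth (ψ : ℝ → ℝ) (h : ContDiff ℝ 1 ψ) : traceOne (ofSmooth ψ h) = ψ 1 := by
  refine eqOn_Icc_of_ae_Ioo zero_lt_one (contRep_continuousOn _) h.continuous.continuousOn ?_
    (by simp : (1 : ℝ) ∈ Icc 0 1)
  filter_upwards [contRep_ae (ofSmooth ψ h), ofCont_ae ψ h.continuous] with x h1 h2
  rw [← h1, toL2_ofSmooth, h2]

/-- The trace at `1` as a continuous linear functional on `H¹(0,1)`. -/
def traceL : H1 →L[ℝ] ℝ :=
  (innerSL ℝ (ofCont (fun _ => 1) continuous_const)).comp toL2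
    + (innerSL ℝ (ofCont (fun x => x) continuous_id)).comp dx

lemma traceL_apply (v : H1) : traceL v = traceOne v := by
  have e := integral_mul_deriv v (contDiff_id (n := 1))
  simp only [traceL, add_apply, ContinuousLinearMap.comp_apply,
    innerSL_apply_apply]
  rw [real_inner_comm, inner_ofCont, real_inner_comm, inner_ofCont]
  simp only [id, deriv_id', mul_one, mul_zero, sub_zero] at e
  rw [traceOne]
  simp only [mul_one]
  linarith

lemma inner_H1 (v w : H1) :
    inner ℝ v w = inner ℝ (toL2 v) (toL2 w) + inner ℝ (dx v) (dx w) := rfl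

/-- An element of `L²(0,1)` orthogonal to all test functions is zero. -/
lemma eq_zero_of_inner_ofCont (f : L2)
    (h : ∀ ψ (hψ : Continuous ψ), HasCompactSupport ψ → tsupport ψ ⊆ Ioo 0 1 → ContDiff ℝ ∞ ψ →
      inner ℝ f (ofCont ψ hψ) = 0) : f = 0 := by
  have hf : IntegrableOn f (Ioo 0 1) := integrable_of_Lp f
  have main := isOpen_Ioo.ae_eq_zero_of_integral_contDiff_smul_eq_zero (μ := volume)
    (f := f) hf.locallyIntegrableOn ?_
  · rw [Lp.eq_zero_iff_ae_eq_zero]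
    rw [EventuallyEq, ae_restrict_iff' measurableSet_Ioo]
    exact main
  · intro ψ h1 h2 h3
    have e := h ψ h1.continuous h2 h3 h1
    rw [inner_ofCont] at e
    refine Eq.trans (Eq.symm (setIntegral_eq_integral_of_forall_compl_eq_zero
      (s := Ioo (0 : ℝ) 1) ?_)) (Eq.trans ?_ e)
    · intro x hx
      rw [image_eq_zero_of_notMem_tsupport fun hh => hx (h3 hh), zero_smul]
    · exact integral_congr_ae (ae_of_all _ fun x => by simp [mul_comm])

/-- The weak derivative is determined by the function, so the second component of a pair carries no
extra freedom. -/
lemma toL2_injective : Function.Injective toL2 := by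
  rw [injective_iff_map_eq_zero]
  intro v hv
  have hd : dx v = 0 := by
    apply eq_zero_of_inner_ofCont
    intro ψ hψ h1 h2 h3
    have e := v.2 ψ ⟨h3, h1, h2⟩
    have e' : ∫ x in Ioo (0 : ℝ) 1, toL2 v x * deriv ψ x
      = - ∫ x in Ioo (0 : ℝ) 1, dx v x * ψ x := e
    rw [← inner_ofCont _ _ (h3.continuous_deriv (by simp)), hv, inner_zero_left] at e'
    rw [inner_ofCont]
    linarith
  have : inner ℝ v v = 0 := by rw [inner_H1, hv, hd]; simp
  simpa using this

instance : CompleteSpace H1 := by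
  have : IsClosed (H1Submodule : Set (WithLp 2 (L2 × L2))) := by
    have : (H1Submodule : Set (WithLp 2 (L2 × L2)))
        = ⋂ (φ : ℝ → ℝ) (_ : IsTest 0 1 φ), {w | ∫ x in Ioo (0 : ℝ) 1, w.fst x * deriv φ x
            = - ∫ x in Ioo (0 : ℝ) 1, w.snd x * φ x} := by
      ext w
      simp only [mem_iInter]
      rfl
    rw [this]
    refine isClosed_iInter fun φ => isClosed_iInter fun hφ => ?_
    simp only [← inner_ofCont _ _ (hφ.smooth.continuous_deriv (by simp)),
      ← inner_ofCont _ _ hφ.smooth.continuous]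
    apply isClosed_eq
    · exact (WithLp.fstL 2 ℝ L2 L2).continuous.inner continuous_const
    · exact ((WithLp.sndL 2 ℝ L2 L2).continuous.inner continuous_const).neg
  exact this.completeSpace_coe

/-! ### The cosine basis -/

/-- The eigenvalues `(nπ)²` of the Neumann Laplacian on `(0,1)`. -/
def lam (n : ℕ) : ℝ := (n * Real.pi) ^ 2

/-- The normalization constants of the cosine basis. -/
def kap (n : ℕ) : ℝ := if n = 0 then 1 else √2

/-- The normalized Neumann eigenfunctions. -/
def cosFun (n : ℕ) (x : ℝ) : ℝ := kap n * Real.cos (n * Real.pi * x)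

lemma contDiff_cosFun (n : ℕ) : ContDiff ℝ 1 (cosFun n) := by
  unfold cosFun
  fun_prop

/-- The Neumann eigenfunctions as elements of `H¹(0,1)`. -/
def eig (n : ℕ) : H1 := ofSmooth (cosFun n) (contDiff_cosFun n)

/-- The boundary values of the Neumann eigenfunctions. -/
def bval (n : ℕ) : ℝ := traceOne (eig n)

lemma lam_nonneg (n : ℕ) : 0 ≤ lam n := sq_nonneg _

lemma sq_le_lam (n : ℕ) : (n : ℝ) ^ 2 ≤ lam n := by
  unfold lam
  have h1 : 1 ≤ Real.pi := by linarith [Real.pi_gt_three]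
  have h2 : (0 : ℝ) ≤ n := n.cast_nonneg
  gcongr
  nlinarith

lemma lam_injective : Function.Injective lam := by
  intro n m h
  have h1 : (0 : ℝ) ≤ n * Real.pi := by positivity
  have h2 : (0 : ℝ) ≤ m * Real.pi := by positivity
  have h3 := (pow_left_inj₀ h1 h2 two_ne_zero).1 h
  exact_mod_cast mul_right_cancel₀ Real.pi_ne_zero h3

lemma one_le_kap (n : ℕ) : 1 ≤ kap n := by
  unfold kap
  split_ifs
  · exact le_rfl
  · exact Real.one_le_sqrt.2 (by norm_num)

lemma kap_le_two (n : ℕ) : kap n ≤ 2 := by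
  unfold kap
  split_ifs
  · norm_num
  · exact Real.sqrt_le_iff.2 (by norm_num)

lemma bval_eq (n : ℕ) : bval n = kap n * (-1) ^ n := by
  rw [bval, eig, traceOne_ofSmooth, cosFun, mul_one, Real.cos_nat_mul_pi]

lemma abs_bval (n : ℕ) : |bval n| = kap n := by
  rw [bval_eq, abs_mul, abs_pow, abs_neg, abs_one, one_pow, mul_one,
    abs_of_nonneg (zero_le_one.trans (one_le_kap n))]

lemma abs_bval_le (n : ℕ) : |bval n| ≤ 2 := by
  rw [abs_bval]
  exact kap_le_two n

lemma deriv_cosFun (n : ℕ) :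
    deriv (cosFun n) = fun x => -(kap n * (n * Real.pi)) * Real.sin (n * Real.pi * x) := by
  ext x
  have h : HasDerivAt (cosFun n) (kap n * (-Real.sin (n * Real.pi * x) * (n * Real.pi * 1))) x :=
    (((hasDerivAt_id x).const_mul _).cos).const_mul _
  rw [h.deriv]
  ring

/-- One integration by parts moves the derivative onto the eigenfunction. The boundary terms vanish
because `sin (n π x)` is zero at both ends, so no condition on `v` is needed. -/
lemma inner_dx_eig (v : H1) (n : ℕ) :
    inner ℝ (dx v) (dx (eig n)) = lam n * inner ℝ (toL2 v) (toL2 (eig n)) := by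
  rw [eig, dx_ofSmooth, toL2_ofSmooth, inner_ofCont, inner_ofCont]
  have hd : deriv (deriv (cosFun n)) = fun x => - lam n * cosFun n x := by
    rw [deriv_cosFun]
    ext x
    have h : HasDerivAt (fun x => -(kap n * (n * Real.pi)) * Real.sin (n * Real.pi * x))
        (-(kap n * (n * Real.pi)) * (Real.cos (n * Real.pi * x) * (n * Real.pi * 1))) x :=
      (((hasDerivAt_id x).const_mul _).sin).const_mul _
    rw [h.deriv, cosFun, lam]
    ring
  have e := integral_mul_deriv v (ψ := deriv (cosFun n)) (by
    rw [deriv_cosFun]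
    fun_prop)
  have h0 : deriv (cosFun n) 0 = 0 := by simp [deriv_cosFun]
  have h1 : deriv (cosFun n) 1 = 0 := by simp [deriv_cosFun, Real.sin_nat_mul_pi]
  rw [hd, h0, h1] at e
  have e2 : ∫ x in Ioo (0 : ℝ) 1, toL2 v x * (-lam n * cosFun n x)
      = - (lam n * ∫ x in Ioo (0 : ℝ) 1, toL2 v x * cosFun n x) := by
    rw [← integral_const_mul, ← integral_neg]
    congr 1
    ext x
    ring
  rw [e2] at e
  linarith

lemma norm_sq_eig (n : ℕ) : inner ℝ (toL2 (eig n)) (toL2 (eig n)) = (1 : ℝ) := by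
  rw [eig, toL2_ofSmooth, inner_ofCont]
  rw [integral_congr_ae (g := fun x => kap n ^ 2 * Real.cos (n * Real.pi * x) ^ 2)
    (by filter_upwards [ofCont_ae _ (contDiff_cosFun n).continuous] with x hx
        rw [hx, cosFun]; ring),
    integral_Ioo_eq zero_le_one, intervalIntegral.integral_const_mul]
  rcases Nat.eq_zero_or_pos n with rfl | hn
  · simp [kap]
  · have hn' : (n : ℝ) * Real.pi ≠ 0 := by positivity
    rw [intervalIntegral.integral_comp_mul_left (fun x => Real.cos x ^ 2) hn', integral_cos_sq]
    simp only [kap, hn.ne', if_false, mul_one, mul_zero, Real.sin_nat_mul_pi, Real.sin_zero,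
      sub_zero, zero_add, smul_eq_mul]
    rw [Real.sq_sqrt (by norm_num)]
    field_simp

lemma orthonormal_eig : Orthonormal ℝ fun n => toL2 (eig n) := by
  refine ⟨fun n => ?_, fun n m hnm => ?_⟩
  · have h := norm_sq_eig n
    rw [real_inner_self_eq_norm_sq] at h
    exact (pow_eq_one_iff_of_nonneg (norm_nonneg _) two_ne_zero).1 h
  -- The symmetric form `(∂ₓ·, ∂ₓ·)` evaluated in both orders gives two eigenvalues for the same
  -- inner product; distinct eigenvalues force orthogonality.
  · have h1 := inner_dx_eig (eig n) m
    have h2 := inner_dx_eig (eig m) n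
    rw [real_inner_comm, h2, real_inner_comm] at h1
    have h3 : (lam n - lam m) * inner ℝ (toL2 (eig n)) (toL2 (eig m)) = 0 := by linarith
    exact (mul_eq_zero.1 h3).resolve_left (sub_ne_zero.2 fun h => hnm (lam_injective h))

lemma integrable_mul_of_continuous (f : L2) {ψ : ℝ → ℝ} (h : Continuous ψ) :
    Integrable (fun x => f x * ψ x) (volume.restrict (Ioo (0 : ℝ) 1)) :=
  (Lp.memLp f).integrable_mul (memLp_of_continuous h)

/-- The cosines are total in `L²(0,1)`. -/
lemma eq_zero_of_inner_eig (f : L2) (hf : ∀ n, inner ℝ f (toL2 (eig n)) = 0) : f = 0 := by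
  have hnat : ∀ n : ℕ, ∫ x in Ioo (0 : ℝ) 1, f x * Real.cos (n * Real.pi * x) = 0 := by
    intro n
    have h := hf n
    rw [eig, toL2_ofSmooth, inner_ofCont] at h
    have h2 : ∫ x in Ioo (0 : ℝ) 1, f x * cosFun n x
        = kap n * ∫ x in Ioo (0 : ℝ) 1, f x * Real.cos (n * Real.pi * x) := by
      rw [← integral_const_mul]
      congr 1
      ext x
      rw [cosFun]
      ring
    rw [h2] at h
    exact (mul_eq_zero.1 h).resolve_left (zero_lt_one.trans_le (one_le_kap n)).ne'
  -- The product formula for `cos (π x) * cos (n π x)` trades one power for the frequencies `n + 1`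
  -- and `n - 1`. Integer `n` keeps the induction closed below zero.
  have hpow : ∀ (k : ℕ) (n : ℤ), ∫ x in Ioo (0 : ℝ) 1,
      f x * (Real.cos (Real.pi * x) ^ k * Real.cos (n * Real.pi * x)) = 0 := by
    intro k
    induction k with
    | zero =>
      intro n
      simp only [pow_zero, one_mul]
      rcases Int.eq_nat_or_neg n with ⟨m, rfl | rfl⟩
      · exact_mod_cast hnat m
      · refine Eq.trans (integral_congr_ae (ae_of_all _ fun x => ?_)) (hnat m)
        beta_reduce
        rw [← Real.cos_neg]
        push_cast
        ring_nf
    | succ k ih =>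
      intro n
      have e : ∀ x : ℝ, f x * (Real.cos (Real.pi * x) ^ (k + 1) * Real.cos (n * Real.pi * x))
          = 1 / 2 * (f x * (Real.cos (Real.pi * x) ^ k * Real.cos ((n + 1 : ℤ) * Real.pi * x)))
            + 1 / 2 * (f x * (Real.cos (Real.pi * x) ^ k
              * Real.cos ((n - 1 : ℤ) * Real.pi * x))) := by
        intro x
        have a1 : ((n + 1 : ℤ) : ℝ) * Real.pi * x = n * Real.pi * x + Real.pi * x := by
          push_cast
          ring
        have a2 : ((n - 1 : ℤ) : ℝ) * Real.pi * x = n * Real.pi * x - Real.pi * x := by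
          push_cast
          ring
        rw [a1, a2, Real.cos_add, Real.cos_sub]
        ring
      simp only [e]
      rw [integral_add, integral_const_mul, integral_const_mul, ih, ih]
      · simp
      · exact (integrable_mul_of_continuous f (by fun_prop)).const_mul _
      · exact (integrable_mul_of_continuous f (by fun_prop)).const_mul _
  have hpoly : ∀ q : Polynomial ℝ, ∫ x in Ioo (0 : ℝ) 1,
      f x * q.eval (Real.cos (Real.pi * x)) = 0 := by
    intro q
    induction q using Polynomial.induction_on' with
    | add p q hp hq =>
      simp only [Polynomial.eval_add, mul_add]
      rw [integral_add, hp, hq, add_zero]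
      · exact integrable_mul_of_continuous f (by fun_prop)
      · exact integrable_mul_of_continuous f (by fun_prop)
    | monomial k a =>
      have h := hpow k 0
      simp only [Int.cast_zero, zero_mul, Real.cos_zero, mul_one] at h
      have h2 := congrArg (a * ·) h
      simp only [mul_zero, ← integral_const_mul] at h2
      refine Eq.trans (integral_congr_ae (ae_of_all _ fun x => ?_)) h2
      simp only [Polynomial.eval_monomial]
      ring
  have hfi : IntegrableOn f (Ioo 0 1) := integrable_of_Lp f
  apply eq_zero_of_inner_ofCont
  intro ψ hψ _ _ _
  rw [inner_ofCont]
  set M := ∫ x in Ioo (0 : ℝ) 1, |f x| with hM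
  have hM0 : 0 ≤ M := integral_nonneg fun x => abs_nonneg _
  have key : ∀ ε > 0, |∫ x in Ioo (0 : ℝ) 1, f x * ψ x| ≤ ε * M := by
    intro ε hε
    -- With `s = cos (π x)` a bijection of `[0,1]` onto `[-1,1]`, Weierstrass approximation in `s`
    -- approximates `ψ` by polynomials in `cos (π x)`, which `f` annihilates.
    obtain ⟨q, hq⟩ := exists_polynomial_near_of_continuousOn (-1) 1
      (fun s => ψ (Real.arccos s / Real.pi))
      (hψ.comp (Real.continuous_arccos.div_const _)).continuousOn ε hε
    have hqc : Continuous fun x => q.eval (Real.cos (Real.pi * x)) := by fun_prop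
    have e : ∫ x in Ioo (0 : ℝ) 1, f x * ψ x
        = ∫ x in Ioo (0 : ℝ) 1, f x * (ψ x - q.eval (Real.cos (Real.pi * x))) := by
      simp only [mul_sub]
      rw [integral_sub (integrable_mul_of_continuous f hψ)
        (integrable_mul_of_continuous f hqc), hpoly, sub_zero]
    rw [e, hM, ← integral_const_mul]
    rw [← Real.norm_eq_abs]
    apply norm_integral_le_of_norm_le (hfi.abs.const_mul ε)
    rw [ae_restrict_iff' measurableSet_Ioo]
    refine ae_of_all _ fun x hx => ?_
    have h := hq (Real.cos (Real.pi * x)) ⟨Real.neg_one_le_cos _, Real.cos_le_one _⟩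
    rw [Real.arccos_cos (mul_nonneg Real.pi_pos.le hx.1.le)
      (by nlinarith [Real.pi_pos, hx.2]), mul_div_cancel_left₀ _ Real.pi_ne_zero] at h
    rw [norm_mul, Real.norm_eq_abs, Real.norm_eq_abs, mul_comm, abs_sub_comm]
    gcongr
  by_contra hne
  have hpos := abs_pos.2 hne
  have h := key (|∫ x in Ioo (0 : ℝ) 1, f x * ψ x| / (2 * (M + 1))) (by positivity)
  rw [div_mul_eq_mul_div, le_div_iff₀ (by positivity)] at h
  nlinarith

/-- The cosine basis of `L²(0,1)`. -/
def cosBasis : HilbertBasis ℕ ℝ L2 :=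
  HilbertBasis.mkOfOrthogonalEqBot orthonormal_eig (by
    rw [Submodule.eq_bot_iff]
    intro f hf
    apply eq_zero_of_inner_eig
    intro n
    rw [real_inner_comm]
    exact (Submodule.mem_orthogonal _ f).1 hf _ (Submodule.subset_span ⟨n, rfl⟩))

lemma cosBasis_apply (n : ℕ) : cosBasis n = toL2 (eig n) := by
  rw [cosBasis, HilbertBasis.coe_mkOfOrthogonalEqBot]

lemma ext_cosBasis {f g : L2} (h : ∀ n, inner ℝ (cosBasis n) f = inner ℝ (cosBasis n) g) :
    f = g := by
  rw [← sub_eq_zero]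
  apply eq_zero_of_inner_eig
  intro n
  rw [← cosBasis_apply, real_inner_comm, inner_sub_right, h n, sub_self]

/-- `L²` and `H¹` coefficients differ only by the factor `1 + lam n`, so totality in `L²` passes to
`H¹`. -/
lemma inner_eig (v : H1) (n : ℕ) :
    inner ℝ (eig n) v = (1 + lam n) * inner ℝ (cosBasis n) (toL2 v) := by
  rw [real_inner_comm, inner_H1, inner_dx_eig, cosBasis_apply, real_inner_comm (toL2 v)]
  ring

lemma one_add_lam_pos (n : ℕ) : 0 < 1 + lam n := by linarith [lam_nonneg n]

lemma inner_eig_eig (n m : ℕ) :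
    inner ℝ (eig n) (eig m) = if n = m then 1 + lam n else (0 : ℝ) := by
  rw [inner_eig, cosBasis_apply, orthonormal_iff_ite.1 orthonormal_eig]
  simp

lemma inner_smul_left_H1 (a : ℝ) (v w : H1) : inner ℝ (a • v) w = a * inner ℝ v w :=
  real_inner_smul_left v w a

lemma inner_smul_right_H1 (a : ℝ) (v w : H1) : inner ℝ v (a • w) = a * inner ℝ v w :=
  real_inner_smul_right v w a

lemma orthonormal_normalized_eig :
    Orthonormal ℝ fun n => (√(1 + lam n))⁻¹ • eig n := by
  rw [orthonormal_iff_ite]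
  intro n m
  rw [inner_smul_left_H1, inner_smul_right_H1, inner_eig_eig]
  split_ifs with h
  · subst h
    have h1 := one_add_lam_pos n
    rw [← mul_assoc, ← mul_inv, Real.mul_self_sqrt h1.le, inv_mul_cancel₀ h1.ne']
  · simp

/-- The normalized cosine basis of `H¹(0,1)`. -/
def cosBasisH1 : HilbertBasis ℕ ℝ H1 :=
  HilbertBasis.mkOfOrthogonalEqBot orthonormal_normalized_eig (by
    rw [Submodule.eq_bot_iff]
    intro w hw
    apply toL2_injective
    rw [map_zero]
    apply eq_zero_of_inner_eig
    intro n
    have h : inner ℝ ((√(1 + lam n))⁻¹ • eig n) w = 0 :=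
      (Submodule.mem_orthogonal _ w).1 hw _ (Submodule.subset_span ⟨n, rfl⟩)
    have h1 := one_add_lam_pos n
    rw [inner_smul_left_H1, inner_eig] at h
    rw [real_inner_comm, ← cosBasis_apply]
    simpa [h1.ne', (Real.sqrt_pos.2 h1).ne'] using h)

/-- Continuous functionals on `H¹(0,1)` can be evaluated on Fourier expansions. -/
lemma hasSum_functional (F : H1 →L[ℝ] ℝ) (v : H1) :
    HasSum (fun n => inner ℝ (cosBasis n) (toL2 v) * F (eig n)) (F v) := by
  convert F.hasSum (cosBasisH1.hasSum_repr v) using 2 with n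
  have h1 := one_add_lam_pos n
  rw [HilbertBasis.repr_apply_apply, cosBasisH1, HilbertBasis.coe_mkOfOrthogonalEqBot,
    inner_smul_left_H1, inner_eig, map_smul, map_smul, smul_eq_mul,
    smul_eq_mul]
  have h2 := Real.sq_sqrt h1.le
  have h3 := (Real.sqrt_pos.2 h1).ne'
  field_simp
  rw [h2]

lemma ext_eig {F G : H1Dual} (h : ∀ n, F (eig n) = G (eig n)) : F = G := by
  ext v
  refine (hasSum_functional F v).unique ?_
  simp only [h]
  exact hasSum_functional G v

lemma summable_inv_one_add_lam : Summable fun n => (1 + lam n)⁻¹ := by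
  -- The majorant `1 / n²` evaluates to `0` at `n = 0`, where the term is `1`; the extra summand
  -- supported at `0` repairs this.
  refine Summable.of_nonneg_of_le (fun n => (inv_pos.2 (one_add_lam_pos n)).le) (fun n => ?_)
    ((Real.summable_one_div_nat_pow.2 one_lt_two).add (summable_of_hasFiniteSupport
      (f := fun n : ℕ => if n = 0 then (1 : ℝ) else 0)
      ((Set.finite_singleton 0).subset (by intro n; simp))))
  rcases Nat.eq_zero_or_pos n with rfl | hn
  · simp [lam]
  · have h := sq_le_lam n
    have hn' : (0 : ℝ) < n := by positivity
    simp only [hn.ne', if_false, add_zero, one_div]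
    exact inv_anti₀ (by positivity) (by linarith)

/-! ### Linear scalar equations in weak form -/

/-- `c' = μ c + f` in the sense of distributions on `(0,T)`. -/
def IsWeakODE (T μ : ℝ) (f c : ℝ → ℝ) : Prop :=
  ∀ φ : ℝ → ℝ, IsTest 0 T φ →
    ∫ t in Ioo (0 : ℝ) T, deriv φ t * c t = - ∫ t in Ioo (0 : ℝ) T, φ t * (μ * c t + f t)

/-- The solution of `c' = μ c + f`, `c(0) = c₀`. -/
def duhamel (μ c₀ : ℝ) (f : ℝ → ℝ) (t : ℝ) : ℝ :=
  Real.exp (μ * t) * ((∫ s in (0 : ℝ)..t, Real.exp (-μ * s) * f s) + c₀)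

lemma intervalIntegrable_exp_mul {T : ℝ} (hT : 0 < T) (μ : ℝ) {f : ℝ → ℝ}
    (hf : IntegrableOn f (Ioo 0 T)) :
    IntervalIntegrable (fun s => Real.exp (-μ * s) * f s) volume 0 T := by
  have h : IntervalIntegrable f volume 0 T := by
    rwa [intervalIntegrable_iff_integrableOn_Ioo_of_le hT.le]
  exact h.continuousOn_mul (by fun_prop)

lemma duhamel_zero (μ c₀ : ℝ) (f : ℝ → ℝ) : duhamel μ c₀ f 0 = c₀ := by simp [duhamel]

lemma continuousOn_duhamel {T : ℝ} (hT : 0 < T) (μ c₀ : ℝ) {f : ℝ → ℝ}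
    (hf : IntegrableOn f (Ioo 0 T)) : ContinuousOn (duhamel μ c₀ f) (Icc 0 T) := by
  have h := ((intervalIntegrable_exp_mul hT μ
    hf).absolutelyContinuousOnInterval_intervalIntegral (c := 0) (by simp)).continuousOn
  rw [uIcc_of_le hT.le] at h
  exact ContinuousOn.mul (by fun_prop) (h.add continuousOn_const)

lemma integrableOn_continuous_mul {a b : ℝ} {ψ c : ℝ → ℝ} (hψ : Continuous ψ)
    (hc : IntegrableOn c (Ioo a b)) : IntegrableOn (fun t => ψ t * c t) (Ioo a b) := by
  obtain ⟨C, hC⟩ := isCompact_Icc.exists_bound_of_continuousOn (s := Icc a b) hψ.continuousOn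
  refine hc.bdd_mul (c := C) hψ.aestronglyMeasurable ?_
  rw [ae_restrict_iff' measurableSet_Ioo]
  exact ae_of_all _ fun x hx => hC x (Ioo_subset_Icc_self hx)

lemma integrableOn_Ioo_of_continuousOn {a b : ℝ} {c : ℝ → ℝ}
    (hc : ContinuousOn c (Icc a b)) : IntegrableOn c (Ioo a b) :=
  (hc.integrableOn_compact isCompact_Icc).mono_set Ioo_subset_Icc_self

lemma IsTest.continuous_deriv {a b : ℝ} {φ : ℝ → ℝ} (h : IsTest a b φ) :
    Continuous (deriv φ) :=
  h.smooth.continuous_deriv (by simp)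

lemma IsTest.apply_left {a b : ℝ} {φ : ℝ → ℝ} (h : IsTest a b φ) : φ a = 0 :=
  image_eq_zero_of_notMem_tsupport fun hh => lt_irrefl _ (h.support hh).1

lemma IsTest.apply_right {a b : ℝ} {φ : ℝ → ℝ} (h : IsTest a b φ) : φ b = 0 :=
  image_eq_zero_of_notMem_tsupport fun hh => lt_irrefl _ (h.support hh).2

lemma IsTest.mul_exp {a b : ℝ} {φ : ℝ → ℝ} (h : IsTest a b φ) (μ : ℝ) :
    IsTest a b fun t => φ t * Real.exp (μ * t) :=
  ⟨h.smooth.mul (by fun_prop), h.compact.mul_right,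
    (closure_mono (Function.support_mul_subset_left _ _)).trans h.support⟩

lemma IsTest.deriv_mul_exp {a b : ℝ} {φ : ℝ → ℝ} (h : IsTest a b φ) (μ : ℝ) :
    deriv (fun t => φ t * Real.exp (μ * t))
      = fun t => deriv φ t * Real.exp (μ * t) + φ t * (μ * Real.exp (μ * t)) := by
  ext t
  have h1 : HasDerivAt φ (deriv φ t) t := (h.smooth.differentiable (by simp) t).hasDerivAt
  have h2 : HasDerivAt (fun t => Real.exp (μ * t)) (Real.exp (μ * t) * (μ * 1)) t :=
    ((hasDerivAt_id t).const_mul μ).exp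
  exact (h1.mul h2).deriv.trans (by ring)

lemma isWeakODE_duhamel {T : ℝ} (hT : 0 < T) (μ c₀ : ℝ) {f : ℝ → ℝ}
    (hf : IntegrableOn f (Ioo 0 T)) : IsWeakODE T μ f (duhamel μ c₀ f) := by
  intro φ hφ
  have hi := intervalIntegrable_exp_mul hT μ hf
  set G : ℝ → ℝ := fun t => (∫ s in (0 : ℝ)..t, Real.exp (-μ * s) * f s) + c₀ with hG
  have hGac : AbsolutelyContinuousOnInterval G 0 T :=
    (hi.absolutelyContinuousOnInterval_intervalIntegral (by simp)).fun_add
      (contDiff_const.contDiffOn (n := 1)).absolutelyContinuousOnInterval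
  have hGd : ∀ᵐ t ∂(volume.restrict (Ioo (0 : ℝ) T)), deriv G t = Real.exp (-μ * t) * f t := by
    rw [ae_restrict_iff' measurableSet_Ioo]
    filter_upwards [hi.ae_hasDerivAt_integral] with x hx hxm
    rw [uIcc_of_le hT.le] at hx
    exact ((hx (Ioo_subset_Icc_self hxm) 0 (by simp [hT.le])).add_const c₀).deriv
  -- The integrating factor goes into the test function, which leaves only the primitive `G` to be
  -- integrated by parts.
  have hψ := hφ.mul_exp μ
  have e := hGac.integral_mul_deriv_eq_deriv_mul
    ((hψ.smooth.of_le (by simp)).contDiffOn.absolutelyContinuousOnInterval (a := 0) (b := T))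
  rw [hφ.apply_left, hφ.apply_right, hφ.deriv_mul_exp, ← integral_Ioo_eq hT.le,
    ← integral_Ioo_eq hT.le] at e
  have hdu : ∀ t, duhamel μ c₀ f t = Real.exp (μ * t) * G t := fun t => rfl
  have hDi : IntegrableOn (duhamel μ c₀ f) (Ioo 0 T) :=
    integrableOn_Ioo_of_continuousOn (continuousOn_duhamel hT μ c₀ hf)
  have e1 : ∫ t in Ioo (0 : ℝ) T, G t * (deriv φ t * Real.exp (μ * t)
        + φ t * (μ * Real.exp (μ * t)))
      = (∫ t in Ioo (0 : ℝ) T, deriv φ t * duhamel μ c₀ f t)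
        + ∫ t in Ioo (0 : ℝ) T, φ t * (μ * duhamel μ c₀ f t) := by
    rw [← integral_add (integrableOn_continuous_mul hφ.continuous_deriv hDi)
      (integrableOn_continuous_mul hφ.smooth.continuous (hDi.const_mul μ))]
    congr 1
    ext t
    rw [hdu]
    ring
  have e2 : ∫ t in Ioo (0 : ℝ) T, deriv G t * (φ t * Real.exp (μ * t))
      = ∫ t in Ioo (0 : ℝ) T, φ t * f t := by
    apply integral_congr_ae
    filter_upwards [hGd] with t ht
    have : Real.exp (-μ * t) * Real.exp (μ * t) = 1 := by
      rw [← Real.exp_add]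
      simp
    rw [ht]
    linear_combination φ t * f t * this
  have e3 : ∫ t in Ioo (0 : ℝ) T, φ t * (μ * duhamel μ c₀ f t + f t)
      = (∫ t in Ioo (0 : ℝ) T, φ t * (μ * duhamel μ c₀ f t))
        + ∫ t in Ioo (0 : ℝ) T, φ t * f t := by
    rw [← integral_add (integrableOn_continuous_mul hφ.smooth.continuous (hDi.const_mul μ))
      (integrableOn_continuous_mul hφ.smooth.continuous hf)]
    congr 1
    ext t
    ring
  rw [e1, e2] at e
  rw [e3]
  linarith

lemma IsTest.comp_div {T : ℝ} (hT : 0 < T) {φ : ℝ → ℝ} (h : IsTest 0 1 φ) :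
    IsTest 0 T fun t => φ (T⁻¹ * t) := by
  have hT' : T⁻¹ ≠ 0 := (inv_pos.2 hT).ne'
  have hs : tsupport (fun t => φ (T⁻¹ * t)) = (fun t => T⁻¹ * t) ⁻¹' tsupport φ :=
    tsupport_comp_eq_preimage φ (Homeomorph.mulLeft₀ T⁻¹ hT')
  refine ⟨h.smooth.comp (by fun_prop), ?_, ?_⟩
  · exact h.compact.comp_homeomorph (Homeomorph.mulLeft₀ T⁻¹ hT')
  · rw [hs]
    intro t ht
    have h1 := h.support ht
    have h2 : t = T * (T⁻¹ * t) := by field_simp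
    constructor
    · rw [h2]
      exact mul_pos hT h1.1
    · rw [h2]
      nlinarith [h1.2]

/-- A continuous function on `[0,T]` with zero weak derivative is constant. -/
lemma eq_of_weakDeriv_zero {T : ℝ} (hT : 0 < T) {c : ℝ → ℝ} (hc : ContinuousOn c (Icc 0 T))
    (h : ∀ φ, IsTest 0 T φ → ∫ t in Ioo (0 : ℝ) T, deriv φ t * c t = 0) {t : ℝ}
    (ht : t ∈ Icc 0 T) : c t = c 0 := by
  have hcc : ContinuousOn (fun x => c (T * x)) (Icc 0 1) := by
    apply hc.comp (by fun_prop)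
    intro x hx
    exact ⟨mul_nonneg hT.le hx.1, by nlinarith [hx.2]⟩
  -- The constancy lemma is stated on `(0,1)`; test functions there are rescaled to `(0,T)`.
  obtain ⟨k, hk⟩ := ae_const_of_weakDeriv_zero (integrableOn_Ioo_of_continuousOn hcc) (fun φ hφ => by
    have e := h _ (hφ.comp_div hT)
    have hd : deriv (fun t => φ (T⁻¹ * t)) = fun t => T⁻¹ * deriv φ (T⁻¹ * t) := by
      ext t
      have h1 : HasDerivAt φ (deriv φ (T⁻¹ * t)) (T⁻¹ * t) :=
        (hφ.smooth.differentiable (by simp) _).hasDerivAt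
      have h2 := h1.comp t ((hasDerivAt_id t).const_mul T⁻¹)
      exact h2.deriv.trans (by ring)
    rw [hd, integral_Ioo_eq hT.le] at e
    rw [integral_Ioo_eq zero_le_one]
    have hs := intervalIntegral.integral_comp_mul_left (a := 0) (b := 1)
      (fun t => T⁻¹ * deriv φ (T⁻¹ * t) * c t) hT.ne'
    rw [mul_zero, mul_one, e, smul_zero] at hs
    have h3 : ∀ x, T⁻¹ * deriv φ (T⁻¹ * (T * x)) * c (T * x)
        = T⁻¹ * (c (T * x) * deriv φ x) := by
      intro x
      rw [inv_mul_cancel_left₀ hT.ne']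
      ring
    simp only [h3, intervalIntegral.integral_const_mul] at hs
    exact (mul_eq_zero.1 hs).resolve_left (inv_pos.2 hT).ne')
  have hE := eqOn_Icc_of_ae_Ioo zero_lt_one hcc continuousOn_const hk
  have e0 : c (T * 0) = k := hE (by simp)
  have e1 : c (T * (t / T)) = k := hE ⟨div_nonneg ht.1 hT.le, (div_le_one hT).2 ht.2⟩
  rw [mul_div_cancel₀ _ hT.ne'] at e1
  rw [mul_zero] at e0
  rw [e1, e0]

/-- Continuous weak solutions of `c' = μ c + f` are given by the variation of constants. -/
lemma IsWeakODE.eq_duhamel {T : ℝ} (hT : 0 < T) {μ : ℝ} {f c : ℝ → ℝ}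
    (hf : IntegrableOn f (Ioo 0 T)) (hc : ContinuousOn c (Icc 0 T)) (h : IsWeakODE T μ f c)
    {t : ℝ} (ht : t ∈ Icc 0 T) : c t = duhamel μ (c 0) f t := by
  have hD := continuousOn_duhamel hT μ (c 0) hf
  have hw := isWeakODE_duhamel hT μ (c 0) hf
  set D := duhamel μ (c 0) f with hDdef
  -- The difference of two solutions solves the homogeneous equation, so its product with the
  -- integrating factor is constant, and it starts at zero.
  have hconst := eq_of_weakDeriv_zero hT (c := fun t => Real.exp (-μ * t) * (c t - D t))
    (ContinuousOn.mul (by fun_prop) (hc.sub hD)) (fun φ hφ => by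
      have hψ := hφ.mul_exp (-μ)
      have e1 := h _ hψ
      have e2 := hw _ hψ
      have hci := integrableOn_Ioo_of_continuousOn hc
      have hDi := integrableOn_Ioo_of_continuousOn hD
      have i1 := integrableOn_continuous_mul hψ.continuous_deriv hci
      have i2 := integrableOn_continuous_mul hψ.continuous_deriv hDi
      have i3 : IntegrableOn (fun t => φ t * Real.exp (-μ * t) * (μ * c t + f t)) (Ioo 0 T) :=
        integrableOn_continuous_mul hψ.smooth.continuous ((hci.const_mul μ).add hf)
      have i4 : IntegrableOn (fun t => φ t * Real.exp (-μ * t) * (μ * D t + f t)) (Ioo 0 T) :=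
        integrableOn_continuous_mul hψ.smooth.continuous ((hDi.const_mul μ).add hf)
      have e3 : ∫ t in Ioo (0 : ℝ) T, deriv φ t * (Real.exp (-μ * t) * (c t - D t))
          = (∫ t in Ioo (0 : ℝ) T, deriv (fun t => φ t * Real.exp (-μ * t)) t * c t)
            - (∫ t in Ioo (0 : ℝ) T, deriv (fun t => φ t * Real.exp (-μ * t)) t * D t)
            + ((∫ t in Ioo (0 : ℝ) T, φ t * Real.exp (-μ * t) * (μ * c t + f t))
            - ∫ t in Ioo (0 : ℝ) T, φ t * Real.exp (-μ * t) * (μ * D t + f t)) := by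
        rw [← integral_sub i1 i2, ← integral_sub i3 i4,
          ← integral_add (i1.fun_sub i2) (i3.fun_sub i4)]
        congr 1
        ext t
        simp only [hφ.deriv_mul_exp]
        ring
      rw [e3, e1, e2]
      ring) ht
  simp only [mul_zero, Real.exp_zero, hDdef, duhamel_zero, sub_self] at hconst
  have := (mul_eq_zero.1 hconst).resolve_left (Real.exp_ne_zero _)
  linarith

/-! ### Weak solutions and their Fourier coefficients -/

/-- The bilinear form `(v,w) ↦ (S v, S w)` on `H¹(0,1)`. -/
def bil (S : H1 →L[ℝ] L2) : H1 →L[ℝ] H1Dual :=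
  LinearMap.mkContinuous₂ (LinearMap.mk₂ ℝ (fun v w : H1 => (inner ℝ (S v) (S w) : ℝ))
    (fun a b c => by rw [map_add, inner_add_left])
    (fun a b c => by rw [map_smul, real_inner_smul_left, smul_eq_mul])
    (fun a b c => by rw [map_add, inner_add_right])
    (fun a b c => by rw [map_smul, real_inner_smul_right, smul_eq_mul])) (‖S‖ * ‖S‖) (by
    intro v w
    calc ‖(inner ℝ (S v) (S w) : ℝ)‖ ≤ ‖S v‖ * ‖S w‖ := norm_inner_le_norm _ _
      _ ≤ (‖S‖ * ‖v‖) * (‖S‖ * ‖w‖) := by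
          gcongr
          · exact S.le_opNorm v
          · exact S.le_opNorm w
      _ = _ := by ring)

/-- The `n`-th Fourier coefficient as a functional on `H¹(0,1)`. -/
def coef (n : ℕ) : H1 →L[ℝ] ℝ := (innerSL ℝ (cosBasis n)).comp toL2

lemma coef_apply (n : ℕ) (v : H1) : coef n v = inner ℝ (cosBasis n) (toL2 v) := rfl

lemma coef_eig (n m : ℕ) : coef n (eig m) = if n = m then 1 else 0 := by
  rw [coef_apply, cosBasis_apply, orthonormal_iff_ite.1 orthonormal_eig]

lemma integrable_test_smul {T : ℝ} {X : Type} [NormedAddCommGroup X] [NormedSpace ℝ X]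
    {ψ : ℝ → ℝ} (hψ : Continuous ψ) {f : ℝ → X} (hf : IntegrableOn f (Ioo 0 T)) :
    IntegrableOn (fun t => ψ t • f t) (Ioo 0 T) := by
  obtain ⟨C, hC⟩ := isCompact_Icc.exists_bound_of_continuousOn (s := Icc 0 T) hψ.continuousOn
  refine hf.bdd_smul C hψ.aestronglyMeasurable ?_
  rw [ae_restrict_iff' measurableSet_Ioo]
  exact ae_of_all _ fun x hx => hC x (Ioo_subset_Icc_self hx)

lemma integral_smul_functional {T : ℝ} {X : Type} [NormedAddCommGroup X] [NormedSpace ℝ X]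
    {ψ : ℝ → ℝ} (hψ : Continuous ψ) (f : ℝ → StrongDual ℝ X) (g : L2T T (StrongDual ℝ X))
    (hfg : ∀ᵐ t ∂(volume.restrict (Ioo (0 : ℝ) T)), g t = f t) (v : X) :
    (∫ t in Ioo (0 : ℝ) T, ψ t • f t) v = ∫ t in Ioo (0 : ℝ) T, ψ t * f t v := by
  rw [ContinuousLinearMap.integral_apply
    (integrable_test_smul hψ ((integrable_of_Lp g).congr hfg))]
  rfl

lemma exists_compLp {T : ℝ} {X Y : Type} [NormedAddCommGroup X] [NormedSpace ℝ X]
    [NormedAddCommGroup Y] [NormedSpace ℝ Y] (B : X →L[ℝ] Y) (y : L2T T X) :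
    ∃ g : L2T T Y, ∀ᵐ t ∂(volume.restrict (Ioo (0 : ℝ) T)), g t = B (y t) :=
  ⟨B.compLp y, B.coeFn_compLp y⟩

lemma exists_compDual {T : ℝ} (B : H1 →L[ℝ] H1Dual) (y : L2T T H1) :
    ∃ g : L2T T H1Dual, ∀ᵐ t ∂(volume.restrict (Ioo (0 : ℝ) T)), g t = B (y t) :=
  exists_compLp (X := H1) (Y := H1Dual) B y

/-- The weak time derivative can be tested with one element of `H¹(0,1)` at a time. -/
lemma isTimeDeriv_iff {T : ℝ} {y : L2T T H1} {g : L2T T H1Dual} :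
    IsTimeDeriv T y g ↔ ∀ φ : ℝ → ℝ, IsTest 0 T φ → ∀ n,
      ∫ t in Ioo (0 : ℝ) T, deriv φ t * coef n (y t)
        = - ∫ t in Ioo (0 : ℝ) T, φ t * g t (eig n) := by
  refine forall₂_congr fun φ hφ => ?_
  have e1 : ∀ n, (∫ t in Ioo (0 : ℝ) T, deriv φ t • toDual (y t)) (eig n)
      = ∫ t in Ioo (0 : ℝ) T, deriv φ t * coef n (y t) := by
    intro n
    -- Writing the Gelfand embedding as the bounded operator `bil toL2` shows that its image of `y`
    -- is Bochner integrable, which allows evaluation at `eig n` under the integral.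
    obtain ⟨g, hg⟩ := exists_compDual (bil toL2) y
    refine (integral_smul_functional (X := H1) hφ.continuous_deriv (fun t => toDual (y t))
      g hg (eig n)).trans ?_
    congr 1
    ext t
    rw [coef_apply, cosBasis_apply, real_inner_comm]
    rfl
  have e2 : ∀ n, (∫ t in Ioo (0 : ℝ) T, φ t • g t) (eig n)
      = ∫ t in Ioo (0 : ℝ) T, φ t * g t (eig n) := fun n =>
    integral_smul_functional (X := H1) hφ.smooth.continuous g g (ae_of_all _ fun _ => rfl) _
  constructor
  · intro h n
    rw [← e1, ← e2, h]
    rfl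
  · intro h
    apply ext_eig
    intro n
    rw [e1, h, ← e2]
    rfl

/-- `y` is a weak solution of `∂ₜy = -σ ∂ₓ²y` with Neumann data `0` and `u`. -/
def IsWeakSol (T σ : ℝ) (u : ℝ → ℝ) (y : L2T T H1) : Prop :=
  ∃ g : L2T T H1Dual, IsTimeDeriv T y g ∧
    ∀ᵐ t ∂(volume.restrict (Ioo (0 : ℝ) T)), ∀ v : H1,
      g t v = σ * inner ℝ (dx (y t)) (dx v) + u t * traceOne v

lemma isState_iff {T : ℝ} {u : L2T T ℝ} {y : L2T T H1} :
    IsState T u y ↔ IsWeakSol T (-1) u y ∧ HasTimeTrace T y 0 0 := by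
  refine and_congr_left fun _ => exists_congr fun g => and_congr_right fun _ => ?_
  refine eventually_congr (ae_of_all _ fun t => forall_congr' fun v => ?_)
  constructor <;> intro h <;> linarith

lemma isAdjointState_iff {T : ℝ} {w : L2} {p : L2T T H1} :
    IsAdjointState T w p ↔ IsWeakSol T 1 (fun _ => 0) p ∧ HasTimeTrace T p T w := by
  refine and_congr_left fun _ => exists_congr fun g => and_congr_right fun _ => ?_
  refine eventually_congr (ae_of_all _ fun t => forall_congr' fun v => ?_)
  constructor <;> intro h <;> linarith

lemma isWeakSol_rhs {T σ : ℝ} {u : ℝ → ℝ} {y : L2T T H1} {g : L2T T H1Dual}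
    (hg : ∀ᵐ t ∂(volume.restrict (Ioo (0 : ℝ) T)), ∀ v : H1,
      g t v = σ * inner ℝ (dx (y t)) (dx v) + u t * traceOne v) (φ : ℝ → ℝ) (n : ℕ) :
    ∫ t in Ioo (0 : ℝ) T, φ t * g t (eig n)
      = ∫ t in Ioo (0 : ℝ) T, φ t * (σ * lam n * coef n (y t) + u t * bval n) := by
  apply integral_congr_ae
  filter_upwards [hg] with t ht
  rw [ht, inner_dx_eig, coef_apply, cosBasis_apply, real_inner_comm (toL2 (y t)), bval]
  ring

/-- Testing with an eigenfunction decouples the modes, and the Neumann datum enters the `n`-th one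
with weight `bval n`. -/
lemma IsWeakSol.isWeakODE {T σ : ℝ} {u : ℝ → ℝ} {y : L2T T H1} (h : IsWeakSol T σ u y) (n : ℕ) :
    IsWeakODE T (σ * lam n) (fun t => u t * bval n) fun t => coef n (y t) := by
  obtain ⟨g, hg, hgv⟩ := h
  intro φ hφ
  rw [isTimeDeriv_iff.1 hg φ hφ n, isWeakSol_rhs hgv]

lemma IsWeakODE.congr_ae {T μ : ℝ} {f c d : ℝ → ℝ} (h : IsWeakODE T μ f c)
    (hcd : ∀ᵐ t ∂(volume.restrict (Ioo (0 : ℝ) T)), c t = d t) : IsWeakODE T μ f d := by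
  intro φ hφ
  have e1 : ∫ t in Ioo (0 : ℝ) T, deriv φ t * c t = ∫ t in Ioo (0 : ℝ) T, deriv φ t * d t :=
    integral_congr_ae (by filter_upwards [hcd] with t ht; rw [ht])
  have e2 : ∫ t in Ioo (0 : ℝ) T, φ t * (μ * c t + f t)
      = ∫ t in Ioo (0 : ℝ) T, φ t * (μ * d t + f t) :=
    integral_congr_ae (by filter_upwards [hcd] with t ht; rw [ht])
  rw [← e1, ← e2, h φ hφ]

/-- The Fourier coefficients of a weak solution. -/
lemma IsWeakSol.inner_eq {T σ : ℝ} (hT : 0 < T) {u : ℝ → ℝ} (hu : IntegrableOn u (Ioo 0 T))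
    {y : L2T T H1} (h : IsWeakSol T σ u y) {Y : ℝ → L2} (hY : ContinuousOn Y (Icc 0 T))
    (hYy : ∀ᵐ t ∂(volume.restrict (Ioo (0 : ℝ) T)), Y t = toL2 (y t)) (n : ℕ) {t : ℝ}
    (ht : t ∈ Icc 0 T) :
    inner ℝ (cosBasis n) (Y t)
      = duhamel (σ * lam n) (inner ℝ (cosBasis n) (Y 0)) (fun t => u t * bval n) t := by
  refine IsWeakODE.eq_duhamel hT (hu.mul_const _) (c := fun t => inner ℝ (cosBasis n) (Y t))
    (continuousOn_const.inner hY) ((h.isWeakODE n).congr_ae ?_) ht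
  filter_upwards [hYy] with t ht
  rw [coef_apply, ht]

lemma continuous_rep_unique {T : ℝ} (hT : 0 < T) {y : L2T T H1} {Y Z : ℝ → L2}
    (hY : ContinuousOn Y (Icc 0 T))
    (hYy : ∀ᵐ t ∂(volume.restrict (Ioo (0 : ℝ) T)), Y t = toL2 (y t))
    (hZ : ContinuousOn Z (Icc 0 T))
    (hZy : ∀ᵐ t ∂(volume.restrict (Ioo (0 : ℝ) T)), Z t = toL2 (y t)) : EqOn Y Z (Icc 0 T) := by
  apply eqOn_Icc_of_ae_Ioo hT hY hZ
  filter_upwards [hYy, hZy] with t h1 h2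
  rw [h1, h2]

lemma eq_of_rep_eqOn {T : ℝ} {y z : L2T T H1} {Y Z : ℝ → L2}
    (hYy : ∀ᵐ t ∂(volume.restrict (Ioo (0 : ℝ) T)), Y t = toL2 (y t))
    (hZz : ∀ᵐ t ∂(volume.restrict (Ioo (0 : ℝ) T)), Z t = toL2 (z t))
    (h : EqOn Y Z (Icc 0 T)) : y = z := by
  apply Lp.ext
  filter_upwards [hYy, hZz, ae_restrict_mem measurableSet_Ioo] with t h1 h2 ht
  apply toL2_injective
  rw [← h1, ← h2, h (Ioo_subset_Icc_self ht)]

/-- The Fourier coefficients of the terminal state. -/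
lemma IsState.inner_terminal {T : ℝ} (hT : 0 < T) {u : L2T T ℝ} {y : L2T T H1} {yT : L2}
    (h : IsState T u y) (hy : HasTimeTrace T y T yT) (n : ℕ) :
    inner ℝ (cosBasis n) yT = duhamel (-1 * lam n) 0 (fun t => u t * bval n) T := by
  obtain ⟨h1, Y, hY, hYy, hY0⟩ := isState_iff.1 h
  obtain ⟨Z, hZ, hZy, hZT⟩ := hy
  have hE := continuous_rep_unique hT hY hYy hZ hZy
  have e := h1.inner_eq hT (integrable_of_Lp u) hY hYy n (right_mem_Icc.2 hT.le)
  rwa [hY0, inner_zero_right, hE (right_mem_Icc.2 hT.le), hZT] at e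

lemma IsState.unique {T : ℝ} (hT : 0 < T) {u : L2T T ℝ} {y z : L2T T H1}
    (hy : IsState T u y) (hz : IsState T u z) : y = z := by
  obtain ⟨h1, Y, hY, hYy, hY0⟩ := isState_iff.1 hy
  obtain ⟨h2, Z, hZ, hZz, hZ0⟩ := isState_iff.1 hz
  refine eq_of_rep_eqOn hYy hZz fun t ht => ext_cosBasis fun n => ?_
  rw [h1.inner_eq hT (integrable_of_Lp u) hY hYy n ht,
    h2.inner_eq hT (integrable_of_Lp u) hZ hZz n ht, hY0, hZ0]

lemma HasTimeTrace.unique {T : ℝ} (hT : 0 < T) {y : L2T T H1} {t : ℝ} (ht : t ∈ Icc 0 T)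
    {z w : L2} (hz : HasTimeTrace T y t z) (hw : HasTimeTrace T y t w) : z = w := by
  obtain ⟨Y, hY, hYy, rfl⟩ := hz
  obtain ⟨Z, hZ, hZy, rfl⟩ := hw
  exact continuous_rep_unique hT hY hYy hZ hZy ht

/-- Each mode is its initial coefficient times a nonvanishing exponential, so the value at `T`
determines it just as well as the value at `0`. -/
lemma IsAdjointState.unique {T : ℝ} (hT : 0 < T) {w : L2} {p q : L2T T H1}
    (hp : IsAdjointState T w p) (hq : IsAdjointState T w q) : p = q := by
  obtain ⟨h1, Y, hY, hYy, hY0⟩ := isAdjointState_iff.1 hp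
  obtain ⟨h2, Z, hZ, hZz, hZ0⟩ := isAdjointState_iff.1 hq
  have hd : ∀ μ c t, duhamel μ c (fun _ => 0) t = Real.exp (μ * t) * c := by
    intro μ c t
    simp [duhamel]
  refine eq_of_rep_eqOn hYy hZz fun t ht => ext_cosBasis fun n => ?_
  have eY := fun s hs => h1.inner_eq (t := s) (u := fun _ => 0) hT (integrable_zero _ _ _) hY hYy n hs
  have eZ := fun s hs => h2.inner_eq (t := s) (u := fun _ => 0) hT (integrable_zero _ _ _) hZ hZz n hs
  simp only [zero_mul, hd] at eY eZ
  have e1 := eY T (right_mem_Icc.2 hT.le)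
  have e2 := eZ T (right_mem_Icc.2 hT.le)
  rw [hY0] at e1
  rw [hZ0, e1] at e2
  rw [eY t ht, eZ t ht, mul_left_cancel₀ (Real.exp_ne_zero _) e2]

/-! ### Construction of weak solutions from Fourier coefficients -/

lemma exists_of_coef {a : ℕ → ℝ} (ha : Summable fun n => a n ^ 2) :
    ∃ f : L2, ∀ n, inner ℝ (cosBasis n) f = a n := by
  have hm : Memℓp a 2 := by
    apply memℓp_gen
    simpa using ha
  refine ⟨cosBasis.repr.symm ⟨a, hm⟩, fun n => ?_⟩
  rw [← HilbertBasis.repr_apply_apply, LinearIsometryEquiv.apply_symm_apply]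

lemma hasSum_sq_coef (f : L2) : HasSum (fun n => inner ℝ (cosBasis n) f ^ 2) (‖f‖ ^ 2) := by
  have h := cosBasis.hasSum_inner_mul_inner f f
  rw [real_inner_self_eq_norm_sq] at h
  have e : (fun n => (inner ℝ (cosBasis n) f : ℝ) ^ 2)
      = fun n => inner ℝ f (cosBasis n) * inner ℝ (cosBasis n) f := by
    ext n
    rw [real_inner_comm f, sq]
  rw [e]
  exact h

lemma inner_cosBasis (n m : ℕ) : inner ℝ (cosBasis n) (cosBasis m) = if n = m then (1 : ℝ) else 0 :=
  orthonormal_iff_ite.1 cosBasis.orthonormal n m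

/-- A Fourier series with continuous coefficients and a square summable majorant is continuous. -/
lemma continuousOn_of_coef {S : Set ℝ} {Y : ℝ → L2} {b : ℕ → ℝ} (hb : Summable fun n => b n ^ 2)
    (hc : ∀ n, ContinuousOn (fun t => (inner ℝ (cosBasis n) (Y t) : ℝ)) S)
    (hY : ∀ n, ∀ t ∈ S, |inner ℝ (cosBasis n) (Y t)| ≤ b n) : ContinuousOn Y S := by
  have hlim : TendstoUniformlyOn
      (fun (s : Finset ℕ) t => ∑ n ∈ s, (inner ℝ (cosBasis n) (Y t) : ℝ) • cosBasis n)
      Y atTop S := by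
    rw [Metric.tendstoUniformlyOn_iff]
    intro ε hε
    have h0 := tendsto_tsum_compl_atTop_zero fun n => b n ^ 2
    filter_upwards [h0.eventually (gt_mem_nhds (pow_pos hε 2))] with s hs t ht
    rw [dist_eq_norm]
    set x := Y t - ∑ n ∈ s, (inner ℝ (cosBasis n) (Y t) : ℝ) • cosBasis n with hx
    -- The remainder has exactly the coefficients outside `s`, so its squared norm is bounded by the
    -- tail of the majorant, uniformly in `t`.
    have hcoef : ∀ n, inner ℝ (cosBasis n) x
        = if n ∈ s then (0 : ℝ) else inner ℝ (cosBasis n) (Y t) := by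
      intro n
      rw [hx, inner_sub_right, inner_sum]
      simp only [real_inner_smul_right, inner_cosBasis, mul_ite, mul_one, mul_zero,
        Finset.sum_ite_eq]
      split_ifs <;> simp
    have h1 := hasSum_sq_coef x
    have h2 : HasSum ((sᶜ : Set ℕ).indicator fun n => b n ^ 2)
        (∑' n : (sᶜ : Set ℕ), b n ^ 2) := by
      rw [tsum_subtype (sᶜ : Set ℕ) fun n => b n ^ 2]
      exact (hb.indicator _).hasSum
    have h3 : ‖x‖ ^ 2 ≤ ∑' n : (sᶜ : Set ℕ), b n ^ 2 := by
      refine hasSum_le (fun n => ?_) h1 h2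
      rw [hcoef]
      by_cases hn : n ∈ s
      · simp [hn]
      · simp only [hn, if_false, mem_compl_iff, Finset.mem_coe, not_false_eq_true,
          indicator_of_mem]
        exact sq_le_sq' (by linarith [neg_abs_le (inner ℝ (cosBasis n) (Y t) : ℝ), hY n t ht])
          ((le_abs_self _).trans (hY n t ht))
    exact lt_of_pow_lt_pow_left₀ 2 hε.le (h3.trans_lt hs)
  exact hlim.continuousOn (Frequently.of_forall fun s =>
    continuousOn_finsetSum s fun n _ => (hc n).smul continuousOn_const)

/-- Passing to the lines spanned by the vectors avoids normalizing them, since some may be zero. -/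
lemma summable_of_orthogonal {E : Type} [NormedAddCommGroup E] [InnerProductSpace ℝ E]
    [CompleteSpace E] {F : ℕ → E} (h : ∀ n m, n ≠ m → inner ℝ (F n) (F m) = (0 : ℝ))
    (hs : Summable fun n => ‖F n‖ ^ 2) : Summable F := by
  have hV : OrthogonalFamily ℝ (fun n => (ℝ ∙ F n : Submodule ℝ E))
      fun n => (ℝ ∙ F n : Submodule ℝ E).subtypeₗᵢ := by
    apply OrthogonalFamily.of_pairwise
    intro n m hnm
    rw [Function.onFun, Submodule.isOrtho_span]
    rintro _ rfl _ rfl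
    exact h n m hnm
  exact (hV.summable_iff_norm_sq_summable
    fun n => ⟨F n, Submodule.mem_span_singleton_self _⟩).2 hs

/-- An element of `L²(0,T;X)` with prescribed coefficients along an orthogonal sequence. -/
lemma exists_L2T_of_coef {T : ℝ} {X : Type} [NormedAddCommGroup X] [InnerProductSpace ℝ X]
    [CompleteSpace X] (e : ℕ → X) (he : ∀ n m, n ≠ m → inner ℝ (e n) (e m) = (0 : ℝ))
    (K : ℕ → X →L[ℝ] ℝ) (hK : ∀ n m, K n (e m) = if n = m then 1 else 0)
    {c : ℕ → ℝ → ℝ} (hc : ∀ n, ContinuousOn (c n) (Icc 0 T))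
    (hs : Summable fun n => ‖e n‖ ^ 2 * ∫ t in Ioo (0 : ℝ) T, c n t ^ 2) :
    ∃ y : L2T T X, ∀ n, ∀ᵐ t ∂(volume.restrict (Ioo (0 : ℝ) T)), K n (y t) = c n t := by
  have hcm : ∀ n, MemLp (c n) 2 (volume.restrict (Ioo (0 : ℝ) T)) := by
    intro n
    obtain ⟨C, hC⟩ := isCompact_Icc.exists_bound_of_continuousOn (hc n)
    refine MemLp.of_bound (((hc n).mono Ioo_subset_Icc_self).aestronglyMeasurable
      measurableSet_Ioo) C ?_
    rw [ae_restrict_iff' measurableSet_Ioo]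
    exact ae_of_all _ fun x hx => hC x (Ioo_subset_Icc_self hx)
  let C : ℕ → L2T T ℝ := fun n => (hcm n).toLp (c n)
  have hC : ∀ n, ∀ᵐ t ∂(volume.restrict (Ioo (0 : ℝ) T)), C n t = c n t := fun n =>
    (hcm n).coeFn_toLp
  let F : ℕ → L2T T X := fun n => (ContinuousLinearMap.toSpanSingleton ℝ (e n)).compLp (C n)
  have hF : ∀ n, ∀ᵐ t ∂(volume.restrict (Ioo (0 : ℝ) T)), F n t = c n t • e n := by
    intro n
    filter_upwards [(ContinuousLinearMap.toSpanSingleton ℝ (e n)).coeFn_compLp (C n), hC n]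
      with t h1 h2
    rw [h1, h2, ContinuousLinearMap.toSpanSingleton_apply]
  have hinner : ∀ n m, (inner ℝ (F n) (F m) : ℝ)
      = inner ℝ (e n) (e m) * ∫ t in Ioo (0 : ℝ) T, c n t * c m t := by
    intro n m
    rw [L2.inner_def, ← integral_const_mul]
    apply integral_congr_ae
    filter_upwards [hF n, hF m] with t h1 h2
    rw [h1, h2, real_inner_smul_left, real_inner_smul_right]
    ring
  have hsum : Summable F := by
    apply summable_of_orthogonal
    · intro n m hnm
      rw [hinner, he n m hnm, zero_mul]
    · convert hs using 2 with n
      rw [← real_inner_self_eq_norm_sq, hinner, real_inner_self_eq_norm_sq]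
      simp only [sq]
  refine ⟨∑' n, F n, fun n => ?_⟩
  -- The coefficient functional acts boundedly on `L²(0,T;X)`, so it can be applied to the series
  -- term by term, and only the `n`-th term survives.
  have h1 := ((K n).compLpL 2 (volume.restrict (Ioo (0 : ℝ) T))).hasSum hsum.hasSum
  have h2 : ∀ m, (K n).compLpL 2 (volume.restrict (Ioo (0 : ℝ) T)) (F m)
      = if n = m then C n else 0 := by
    intro m
    apply Lp.ext
    filter_upwards [(K n).coeFn_compLp (F m), hF m, hC n,
      Lp.coeFn_zero ℝ 2 (volume.restrict (Ioo (0 : ℝ) T))] with t a1 a2 a3 a4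
    refine a1.trans ?_
    rw [a2, map_smul, hK]
    split_ifs with h
    · subst h
      simp [a3]
    · exact (smul_zero _).trans a4.symm
  have h3 : HasSum (fun m => (K n).compLpL 2 (volume.restrict (Ioo (0 : ℝ) T)) (F m)) (C n) := by
    simp only [h2]
    exact hasSum_ite_eq' n (C n)
  have h4 := h1.unique h3
  filter_upwards [(K n).coeFn_compLp (∑' n, F n), hC n] with t a1 a2
  rw [← a1, ← a2, ← h4]
  rfl

/-- A weak solution with prescribed Fourier coefficients. -/
lemma exists_isWeakSol {T σ : ℝ} (u : L2T T ℝ) {c : ℕ → ℝ → ℝ} {b : ℕ → ℝ}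
    (hc : ∀ n, ContinuousOn (c n) (Icc 0 T))
    (hw : ∀ n, IsWeakODE T (σ * lam n) (fun t => u t * bval n) (c n))
    (hs : Summable fun n => (1 + lam n) * ∫ t in Ioo (0 : ℝ) T, c n t ^ 2)
    (hb : Summable fun n => b n ^ 2) (hcb : ∀ n, ∀ t ∈ Icc 0 T, |c n t| ≤ b n) :
    ∃ y : L2T T H1, IsWeakSol T σ u y ∧
      (∀ n, ∀ᵐ t ∂(volume.restrict (Ioo (0 : ℝ) T)), coef n (y t) = c n t) ∧
      ∀ t ∈ Icc 0 T, ∀ z : L2, (∀ n, inner ℝ (cosBasis n) z = c n t) → HasTimeTrace T y t z := by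
  have hnorm : ∀ n, ‖eig n‖ ^ 2 = 1 + lam n := by
    intro n
    have h := inner_eig_eig n n
    rwa [if_pos rfl, real_inner_self_eq_norm_sq] at h
  obtain ⟨y, hy⟩ := exists_L2T_of_coef (T := T) (X := H1) eig
    (fun n m hnm => by rw [inner_eig_eig, if_neg hnm]) coef coef_eig hc (by simpa only [hnorm])
  refine ⟨y, ?_, hy, ?_⟩
  -- The time derivative is read off from the equation itself; that it really is the derivative is
  -- then checked mode by mode.
  · obtain ⟨g1, hg1⟩ := exists_compDual (σ • bil dx) y
    obtain ⟨g2, hg2⟩ := exists_compLp (X := ℝ) (Y := H1Dual)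
      (ContinuousLinearMap.toSpanSingleton ℝ traceL) u
    have hg : ∀ᵐ t ∂(volume.restrict (Ioo (0 : ℝ) T)), ∀ v : H1,
        (g1 + g2 : L2T T H1Dual) t v
          = σ * inner ℝ (dx (y t)) (dx v) + u t * traceOne v := by
      filter_upwards [hg1, hg2, Lp.coeFn_add g1 g2] with t a1 a2 a3 v
      rw [a3, Pi.add_apply, a1, a2, ← traceL_apply]
      rfl
    refine ⟨g1 + g2, isTimeDeriv_iff.2 fun φ hφ n => ?_, hg⟩
    rw [isWeakSol_rhs hg]
    exact (hw n).congr_ae (by filter_upwards [hy n] with t ht; rw [ht]) φ hφ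
  · intro t ht z hz
    have hex : ∀ s, ∃ f : L2, s ∈ Icc 0 T → ∀ n, inner ℝ (cosBasis n) f = c n s := by
      intro s
      by_cases hsT : s ∈ Icc 0 T
      · obtain ⟨f, hf⟩ := exists_of_coef (a := fun n => c n s)
          (hb.of_nonneg_of_le (fun n => sq_nonneg _) fun n => by
            rw [← sq_abs (c n s)]
            exact pow_le_pow_left₀ (abs_nonneg _) (hcb n s hsT) 2)
        exact ⟨f, fun _ => hf⟩
      · exact ⟨0, fun h => absurd h hsT⟩
    choose Y hY using hex
    refine ⟨Y, ?_, ?_, ?_⟩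
    · apply continuousOn_of_coef hb
      · intro n
        exact (hc n).congr fun s hs => hY s hs n
      · intro n s hs
        rw [hY s hs n]
        exact hcb n s hs
    · filter_upwards [ae_all_iff.2 hy, ae_restrict_mem measurableSet_Ioo] with s h1 h2
      apply ext_cosBasis
      intro n
      rw [hY s (Ioo_subset_Icc_self h2), ← h1 n, coef_apply]
    · apply ext_cosBasis
      intro n
      rw [hY t ht, hz]

/-! ### Existence of states and adjoint states -/

/-- The integral is at most `t * exp (μ t)`, and `μ` times it equals `exp (μ t) - 1`. Adding the two
gives a bound that is uniform down to `μ = 0`, as the constant mode requires. -/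
lemma integral_exp_mul_le {μ t : ℝ} (hμ : 0 ≤ μ) (ht : 0 ≤ t) :
    (1 + μ) * ∫ s in (0 : ℝ)..t, Real.exp (μ * s) ≤ (1 + t) * Real.exp (μ * t) := by
  have hi : ∀ a b : ℝ, IntervalIntegrable (fun s => Real.exp (μ * s)) volume a b := fun a b =>
    (by fun_prop : Continuous fun s => Real.exp (μ * s)).intervalIntegrable a b
  have h1 : ∫ s in (0 : ℝ)..t, μ * Real.exp (μ * s) = Real.exp (μ * t) - 1 := by
    rw [intervalIntegral.integral_eq_sub_of_hasDerivAt (f := fun s => Real.exp (μ * s))]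
    · simp
    · intro s _
      exact (((hasDerivAt_id s).const_mul μ).exp).congr_deriv (by simp [mul_comm])
    · exact (hi _ _).const_mul μ
  have h2 : ∫ s in (0 : ℝ)..t, Real.exp (μ * s) ≤ ∫ _ in (0 : ℝ)..t, Real.exp (μ * t) := by
    apply intervalIntegral.integral_mono_on ht (hi _ _) (by simp)
    intro s hs
    exact Real.exp_le_exp.2 (mul_le_mul_of_nonneg_left hs.2 hμ)
  rw [intervalIntegral.integral_const, sub_zero, smul_eq_mul] at h2
  rw [intervalIntegral.integral_const_mul] at h1
  nlinarith

lemma abs_duhamel_le {T μ : ℝ} (hμ : 0 ≤ μ) {f : ℝ → ℝ} {C : ℝ} (hC : 0 ≤ C)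
    (hf : ∀ᵐ t ∂(volume.restrict (Ioo (0 : ℝ) T)), |f t| ≤ C) {t : ℝ} (ht : t ∈ Icc 0 T) :
    |duhamel (-1 * μ) 0 f t| ≤ C * (1 + T) / (1 + μ) := by
  have h1 : ‖∫ s in (0 : ℝ)..t, Real.exp (μ * s) * f s‖
      ≤ ∫ s in (0 : ℝ)..t, C * Real.exp (μ * s) := by
    apply intervalIntegral.norm_integral_le_of_norm_le ht.1
    · rw [ae_restrict_iff' measurableSet_Ioo] at hf
      -- The bound on `f` holds on the open interval, while the integral up to `t = T` runs over a
      -- half-open one.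
      have hne : ∀ᵐ s : ℝ, s ≠ T := compl_mem_ae_iff.2 (measure_singleton T)
      filter_upwards [hf, hne] with s h1 h2 hs
      rw [norm_mul, Real.norm_eq_abs, Real.norm_eq_abs, Real.abs_exp, mul_comm]
      exact mul_le_mul_of_nonneg_right
        (h1 ⟨hs.1, lt_of_le_of_ne (hs.2.trans ht.2) h2⟩) (Real.exp_pos _).le
    · exact (by fun_prop : Continuous fun s => C * Real.exp (μ * s)).intervalIntegrable _ _
  rw [intervalIntegral.integral_const_mul, Real.norm_eq_abs] at h1
  have h2 := integral_exp_mul_le hμ ht.1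
  rw [duhamel, add_zero, abs_mul, Real.abs_exp, le_div_iff₀ (by linarith)]
  simp only [neg_mul, one_mul, neg_neg]
  calc Real.exp (-(μ * t)) * |∫ s in (0 : ℝ)..t, Real.exp (μ * s) * f s| * (1 + μ)
      ≤ Real.exp (-(μ * t)) * (C * ∫ s in (0 : ℝ)..t, Real.exp (μ * s)) * (1 + μ) := by gcongr
    _ = Real.exp (-(μ * t)) * C * ((1 + μ) * ∫ s in (0 : ℝ)..t, Real.exp (μ * s)) := by ring
    _ ≤ Real.exp (-(μ * t)) * C * ((1 + t) * Real.exp (μ * t)) := by gcongr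
    _ = C * (1 + t) * (Real.exp (-(μ * t)) * Real.exp (μ * t)) := by ring
    _ = C * (1 + t) := by rw [← Real.exp_add]; simp
    _ ≤ C * (1 + T) := by
        have := ht.2
        gcongr

lemma summable_sq_div_one_add_lam (C : ℝ) : Summable fun n => (C / (1 + lam n)) ^ 2 := by
  refine Summable.of_nonneg_of_le (fun n => sq_nonneg _) (fun n => ?_)
    (summable_inv_one_add_lam.mul_left (C ^ 2))
  have h := lam_nonneg n
  rw [div_pow, div_eq_mul_inv]
  have : (1 + lam n) ≤ (1 + lam n) ^ 2 := by nlinarith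
  gcongr

lemma setIntegral_le_of_le {T : ℝ} (hT : 0 ≤ T) {f : ℝ → ℝ} (hf : ContinuousOn f (Icc 0 T))
    {C : ℝ} (h : ∀ t ∈ Icc 0 T, f t ≤ C) : ∫ t in Ioo (0 : ℝ) T, f t ≤ T * C := by
  have h1 : ∫ t in Ioo (0 : ℝ) T, f t ≤ ∫ _ in Ioo (0 : ℝ) T, C := by
    apply setIntegral_mono_on (integrableOn_Ioo_of_continuousOn hf) (by simp) measurableSet_Ioo
    exact fun t ht => h t (Ioo_subset_Icc_self ht)
  rw [integral_Ioo_eq hT, integral_Ioo_eq hT, intervalIntegral.integral_const, sub_zero,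
    smul_eq_mul] at h1
  rwa [integral_Ioo_eq hT]

lemma abs_mul_bval_le {x : ℝ} (hx : |x| ≤ 1) (n : ℕ) : |x * bval n| ≤ 2 := by
  rw [abs_mul]
  nlinarith [abs_bval_le n, abs_nonneg x, abs_nonneg (bval n)]

/-- A bounded control gives coefficients of order `1 / (1 + lam n)`, enough for the `H¹` weight `1 +
lam n` against their squares. -/
lemma exists_state {T : ℝ} (hT : 0 < T) {u : L2T T ℝ} (hu : AdmissibleControl T u) :
    ∃ (y : L2T T H1) (yT : L2), IsState T u y ∧ HasTimeTrace T y T yT := by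
  have hui : ∀ n, IntegrableOn (fun t => u t * bval n) (Ioo 0 T) := fun n =>
    (integrable_of_Lp u).mul_const _
  set C : ℝ := 2 * (1 + T) with hC
  have hc : ∀ n, ContinuousOn (duhamel (-1 * lam n) 0 fun t => u t * bval n) (Icc 0 T) := fun n =>
    continuousOn_duhamel hT _ _ (hui n)
  have hb : ∀ n, ∀ t ∈ Icc 0 T,
      |duhamel (-1 * lam n) 0 (fun t => u t * bval n) t| ≤ C / (1 + lam n) := by
    intro n t ht
    refine abs_duhamel_le (lam_nonneg n) zero_le_two ?_ ht
    filter_upwards [hu] with s hs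
    exact abs_mul_bval_le (abs_le.2 hs) n
  have hbs := summable_sq_div_one_add_lam C
  obtain ⟨y, hy, -, htr⟩ := exists_isWeakSol (σ := -1) u hc
    (fun n => isWeakODE_duhamel hT _ _ (hui n))
    (by
      refine Summable.of_nonneg_of_le (fun n => mul_nonneg (one_add_lam_pos n).le
        (integral_nonneg fun t => sq_nonneg _)) (fun n => ?_)
        (summable_inv_one_add_lam.mul_left (T * C ^ 2))
      have h1 := setIntegral_le_of_le hT.le ((hc n).pow 2) (C := (C / (1 + lam n)) ^ 2)
        fun t ht => by
          rw [Pi.pow_apply, ← sq_abs]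
          exact pow_le_pow_left₀ (abs_nonneg _) (hb n t ht) 2
      have h2 := one_add_lam_pos n
      calc _ ≤ (1 + lam n) * (T * (C / (1 + lam n)) ^ 2) := by gcongr; exact h1
        _ = T * C ^ 2 * (1 + lam n)⁻¹ := by field_simp)
    hbs hb
  obtain ⟨yT, hyT⟩ := exists_of_coef
    (a := fun n => duhamel (-1 * lam n) 0 (fun t => u t * bval n) T)
    (hbs.of_nonneg_of_le (fun n => sq_nonneg _) fun n => by
      rw [← sq_abs (duhamel _ _ _ _)]
      exact pow_le_pow_left₀ (abs_nonneg _) (hb n T (right_mem_Icc.2 hT.le)) 2)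
  refine ⟨y, yT, isState_iff.2 ⟨hy, htr 0 (left_mem_Icc.2 hT.le) 0 fun n => ?_⟩,
    htr T (right_mem_Icc.2 hT.le) yT hyT⟩
  rw [inner_zero_right, duhamel_zero]

/-- The boundary trace of the adjoint state with terminal value `w`. -/
def theta (T : ℝ) (w : L2) (t : ℝ) : ℝ :=
  ∑' n, inner ℝ (cosBasis n) w * bval n * Real.exp (-lam n * (T - t))

lemma IsWeakODE.congr_rhs {T μ : ℝ} {f g c : ℝ → ℝ} (h : IsWeakODE T μ f c)
    (hfg : ∀ᵐ t ∂(volume.restrict (Ioo (0 : ℝ) T)), f t = g t) : IsWeakODE T μ g c := by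
  intro φ hφ
  rw [h φ hφ]
  congr 1
  apply integral_congr_ae
  filter_upwards [hfg] with t ht
  rw [ht]

lemma exp_mul_sub_le_one {μ T t : ℝ} (hμ : 0 ≤ μ) (ht : t ≤ T) :
    Real.exp (-μ * (T - t)) ≤ 1 := by
  rw [Real.exp_le_one_iff]
  nlinarith

lemma integral_exp_mul_sub_le {μ T : ℝ} (hμ : 0 ≤ μ) (hT : 0 ≤ T) :
    (1 + μ) * ∫ t in Ioo (0 : ℝ) T, Real.exp (-μ * (T - t)) ≤ 1 + T := by
  have e : ∀ t, Real.exp (-μ * (T - t)) = Real.exp (-(μ * T)) * Real.exp (μ * t) := by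
    intro t
    rw [← Real.exp_add]
    ring_nf
  simp only [e]
  rw [integral_Ioo_eq hT, intervalIntegral.integral_const_mul]
  have h := mul_le_mul_of_nonneg_left (integral_exp_mul_le hμ hT) (Real.exp_pos (-(μ * T))).le
  have e2 : Real.exp (-(μ * T)) * Real.exp (μ * T) = 1 := by
    rw [← Real.exp_add]
    simp
  linear_combination h + (1 + T) * e2

/-- The terminal coefficients are merely square summable; the `H¹` weight is absorbed by integrating
the squared exponential in time, which gains a factor of order `1 / (1 + lam n)`. The trace series
comes from evaluating `traceL` on the `H¹` expansion. -/
lemma exists_adjoint {T : ℝ} (hT : 0 < T) (w : L2) :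
    ∃ p : L2T T H1, IsAdjointState T w p ∧
      ∀ᵐ t ∂(volume.restrict (Ioo (0 : ℝ) T)), traceOne (p t) = theta T w t := by
  set a : ℕ → ℝ := fun n => inner ℝ (cosBasis n) w with ha
  have has : Summable fun n => |a n| ^ 2 := by
    simp only [sq_abs]
    exact (hasSum_sq_coef w).summable
  set c : ℕ → ℝ → ℝ := fun n t => Real.exp (-lam n * (T - t)) * a n with hcd
  have hc : ∀ n, ContinuousOn (c n) (Icc 0 T) := by
    intro n
    simp only [hcd]
    fun_prop
  obtain ⟨p, hp, hpc, htr⟩ := exists_isWeakSol (T := T) (σ := 1) 0 (c := c)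
    (b := fun n => |a n|) hc
    (fun n => by
      have h := isWeakODE_duhamel hT (1 * lam n) (Real.exp (-lam n * T) * a n)
        (f := fun _ => 0) (integrable_zero _ _ _)
      have e : duhamel (1 * lam n) (Real.exp (-lam n * T) * a n) (fun _ => 0) = c n := by
        ext t
        simp only [duhamel, mul_zero, intervalIntegral.integral_zero, zero_add, hcd, ← mul_assoc,
          ← Real.exp_add]
        ring_nf
      rw [e] at h
      apply h.congr_rhs
      filter_upwards [Lp.coeFn_zero ℝ 2 (volume.restrict (Ioo (0 : ℝ) T))] with t ht
      rw [ht]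
      simp)
    (by
      refine Summable.of_nonneg_of_le (fun n => mul_nonneg (one_add_lam_pos n).le
        (integral_nonneg fun t => sq_nonneg _)) (fun n => ?_) (has.mul_left (1 + T))
      have h1 := integral_exp_mul_sub_le (T := T) (μ := 2 * lam n)
        (by linarith [lam_nonneg n]) hT.le
      have e : ∀ t, c n t ^ 2 = |a n| ^ 2 * Real.exp (-(2 * lam n) * (T - t)) := by
        intro t
        simp only [hcd]
        rw [mul_pow, ← Real.exp_nat_mul, sq_abs, mul_comm]
        push_cast
        ring_nf
      simp only [e]
      rw [integral_const_mul]
      have h2 : 0 ≤ ∫ t in Ioo (0 : ℝ) T, Real.exp (-(2 * lam n) * (T - t)) :=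
        integral_nonneg fun t => (Real.exp_pos _).le
      have h3 : (1 + lam n) * ∫ t in Ioo (0 : ℝ) T, Real.exp (-(2 * lam n) * (T - t)) ≤ 1 + T := by
        nlinarith [lam_nonneg n]
      have h4 := mul_le_mul_of_nonneg_left h3 (sq_nonneg |a n|)
      linarith)
    has
    (fun n t ht => by
      simp only [hcd]
      rw [abs_mul, Real.abs_exp]
      exact mul_le_of_le_one_left (abs_nonneg _) (exp_mul_sub_le_one (lam_nonneg n) ht.2))
  refine ⟨p, isAdjointState_iff.2 ⟨?_, htr T (right_mem_Icc.2 hT.le) w fun n => ?_⟩, ?_⟩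
  · obtain ⟨g, hg, hgv⟩ := hp
    refine ⟨g, hg, ?_⟩
    filter_upwards [hgv, Lp.coeFn_zero ℝ 2 (volume.restrict (Ioo (0 : ℝ) T))] with t h1 h2 v
    rw [h1, h2, Pi.zero_apply]
  · simp [hcd, ha]
  · filter_upwards [ae_all_iff.2 hpc] with t ht
    rw [← traceL_apply, ← (hasSum_functional traceL (p t)).tsum_eq, theta]
    congr 1
    ext n
    rw [← coef_apply, ht, traceL_apply]
    simp only [hcd, ha, bval]
    ring

/-! ### The boundary trace of the adjoint state -/

/-- From `1 + λ ≤ (1 + 1/δ) (1 + λ δ) ≤ (1 + 1/δ) exp (λ δ)`. At any positive distance from `T` this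
makes the trace series summable. -/
lemma exp_neg_lam_mul_le {δ : ℝ} (hδ : 0 < δ) (n : ℕ) :
    Real.exp (-lam n * δ) ≤ (1 + δ⁻¹) * (1 + lam n)⁻¹ := by
  have h0 := lam_nonneg n
  have h1 := Real.add_one_le_exp (lam n * δ)
  have h2 : 0 < 1 + lam n := by linarith
  have e : Real.exp (-lam n * δ) = (Real.exp (lam n * δ))⁻¹ := by
    rw [← Real.exp_neg]
    ring_nf
  rw [e, inv_le_iff_one_le_mul₀ (Real.exp_pos _)]
  have h3 : 1 + lam n ≤ (1 + δ⁻¹) * Real.exp (lam n * δ) := by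
    calc 1 + lam n ≤ (1 + δ⁻¹) * (lam n * δ + 1) := by
          have : δ⁻¹ * δ = 1 := inv_mul_cancel₀ hδ.ne'
          have h4 : 0 < δ⁻¹ := inv_pos.2 hδ
          have h5 : 0 ≤ lam n * δ := by positivity
          have h6 : (1 + δ⁻¹) * (lam n * δ + 1) = lam n * δ + 1 + lam n * (δ⁻¹ * δ) + δ⁻¹ := by
            ring
          rw [h6, this]
          linarith
      _ ≤ _ := by
          have h4 : 0 < δ⁻¹ := inv_pos.2 hδ
          gcongr
  calc (1 : ℝ) = (1 + lam n) * (1 + lam n)⁻¹ := (mul_inv_cancel₀ h2.ne').symm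
    _ ≤ ((1 + δ⁻¹) * Real.exp (lam n * δ)) * (1 + lam n)⁻¹ := by
        have := inv_pos.2 h2
        gcongr
    _ = _ := by ring

lemma abs_coef_le (w : L2) (n : ℕ) : |inner ℝ (cosBasis n) w| ≤ ‖w‖ := by
  have h := norm_inner_le_norm (𝕜 := ℝ) (cosBasis n) w
  rwa [cosBasis.orthonormal.1 n, one_mul] at h

lemma abs_coef_mul_bval_le (w : L2) (n : ℕ) :
    |inner ℝ (cosBasis n) w * bval n| ≤ ‖w‖ * 2 := by
  rw [abs_mul]
  exact mul_le_mul (abs_coef_le w n) (abs_bval_le n) (abs_nonneg _) (norm_nonneg _)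

/-- The series extends holomorphically to the half-planes `Re z < T - δ`, where its terms have a
uniform summable majorant. It also makes sense for negative times, so analyticity at `t = 0` is
two-sided. -/
lemma analyticOnNhd_theta (T : ℝ) (w : L2) : AnalyticOnNhd ℝ (theta T w) (Iio T) := by
  intro t ht
  rw [mem_Iio] at ht
  set δ := (T - t) / 2 with hδ
  have hδ0 : 0 < δ := by linarith
  set F : ℕ → ℂ → ℂ := fun n z =>
    ((inner ℝ (cosBasis n) w * bval n : ℝ) : ℂ) * Complex.exp (-(lam n : ℂ) * (T - z)) with hF
  have hU : IsOpen {z : ℂ | z.re < T - δ} := isOpen_lt Complex.continuous_re continuous_const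
  have hd : DifferentiableOn ℂ (fun z => ∑' n, F n z) {z : ℂ | z.re < T - δ} := by
    refine Complex.differentiableOn_tsum_of_summable_norm
      (u := fun n => ‖w‖ * 2 * ((1 + δ⁻¹) * (1 + lam n)⁻¹))
      ((summable_inv_one_add_lam.mul_left _).mul_left _) (fun n => ?_) hU fun n z hz => ?_
    · simp only [hF]
      fun_prop
    · simp only [hF]
      rw [norm_mul, Complex.norm_real, Real.norm_eq_abs, Complex.norm_exp]
      have hre : (-(lam n : ℂ) * (T - z)).re = -lam n * (T - z.re) := by simp
      rw [hre]
      refine mul_le_mul (abs_coef_mul_bval_le w n) ?_ (Real.exp_pos _).le (by positivity)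
      refine le_trans (Real.exp_le_exp.2 ?_) (exp_neg_lam_mul_le hδ0 n)
      have : z.re < T - δ := hz
      nlinarith [lam_nonneg n]
  have han : AnalyticAt ℂ (fun z => ∑' n, F n z) (t : ℂ) :=
    hd.analyticAt (hU.mem_nhds (by simp only [mem_ofPred_eq, Complex.ofReal_re]; linarith))
  have e : (fun x : ℝ => (∑' n, F n x).re) = theta T w := by
    ext x
    have : ∀ n, F n x = ((inner ℝ (cosBasis n) w * bval n * Real.exp (-lam n * (T - x)) : ℝ) : ℂ) := by
      intro n
      simp only [hF]
      push_cast
      rfl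
    simp only [this]
    rw [← Complex.ofReal_tsum, Complex.ofReal_re, theta]
  rw [← e]
  exact han.re_ofReal

lemma continuousOn_theta (T : ℝ) (w : L2) : ContinuousOn (theta T w) (Iio T) :=
  (analyticOnNhd_theta T w).continuousOn

/-! ### Duality between controls and adjoint traces, and the Baire category argument. -/

lemma integrable_tsum {α : Type} [MeasurableSpace α] {μ : Measure α} {F : ℕ → α → ℝ}
    (hF : ∀ n, Integrable (F n) μ) (hs : Summable fun n => ∫ a, ‖F n a‖ ∂μ)
    (hm : AEStronglyMeasurable (fun a => ∑' n, F n a) μ) :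
    Integrable (fun a => ∑' n, F n a) μ := by
  refine ⟨hm, ?_⟩
  have h1 : ∀ n, ∫⁻ a, ‖F n a‖ₑ ∂μ = ENNReal.ofReal (∫ a, ‖F n a‖ ∂μ) := fun n =>
    (ofReal_integral_norm_eq_lintegral_enorm (hF n)).symm
  calc ∫⁻ a, ‖∑' n, F n a‖ₑ ∂μ ≤ ∫⁻ a, ∑' n, ‖F n a‖ₑ ∂μ :=
        lintegral_mono fun a => enorm_tsum_le_tsum_enorm
    _ = ∑' n, ∫⁻ a, ‖F n a‖ₑ ∂μ := lintegral_tsum fun n => (hF n).1.enorm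
    _ = ∑' n, ENNReal.ofReal (∫ a, ‖F n a‖ ∂μ) := by simp only [h1]
    _ = ENNReal.ofReal (∑' n, ∫ a, ‖F n a‖ ∂μ) :=
        (ENNReal.ofReal_tsum_of_nonneg (fun n => integral_nonneg fun a => norm_nonneg _) hs).symm
    _ < ⊤ := ENNReal.ofReal_lt_top

/-- The pairing of the terminal state with `w`. -/
lemma inner_terminal_eq {T : ℝ} (hT : 0 < T) (w : L2) {u : L2T T ℝ} (hu : AdmissibleControl T u)
    {y : L2T T H1} {yT : L2} (h : IsState T u y) (hy : HasTimeTrace T y T yT) :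
    IntegrableOn (fun t => theta T w t * u t) (Ioo 0 T) ∧
      inner ℝ w yT = ∫ t in Ioo (0 : ℝ) T, theta T w t * u t := by
  set F : ℕ → ℝ → ℝ := fun n t =>
    inner ℝ (cosBasis n) w * bval n * Real.exp (-lam n * (T - t)) * u t with hF
  have hui : IntegrableOn u (Ioo 0 T) := integrable_of_Lp u
  have hFi : ∀ n, IntegrableOn (F n) (Ioo 0 T) := fun n =>
    integrableOn_continuous_mul (ψ := fun t =>
      inner ℝ (cosBasis n) w * bval n * Real.exp (-lam n * (T - t))) (by fun_prop) hui
  have hFt : ∀ t, ∑' n, F n t = theta T w t * u t := by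
    intro t
    simp only [hF]
    rw [tsum_mul_right, theta]
  have hw2 : Summable fun n => (inner ℝ (cosBasis n) w : ℝ) ^ 2 := (hasSum_sq_coef w).summable
  -- This licenses exchanging sum and integral although `theta` may be unbounded at `T`: each
  -- integral is a square summable coefficient times `O(1 / (1 + lam n))`, bounded by the sum of the
  -- two squares.
  have hs : Summable fun n => ∫ t in Ioo (0 : ℝ) T, ‖F n t‖ := by
    refine Summable.of_nonneg_of_le (fun n => integral_nonneg fun t => norm_nonneg _) (fun n => ?_)
      (hw2.add (summable_sq_div_one_add_lam (2 * (1 + T))))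
    have hE : IntegrableOn (fun t => Real.exp (-lam n * (T - t))) (Ioo 0 T) :=
      integrableOn_Ioo_of_continuousOn (by fun_prop)
    have h1 : ∫ t in Ioo (0 : ℝ) T, ‖F n t‖
        ≤ ∫ t in Ioo (0 : ℝ) T, |inner ℝ (cosBasis n) w| * 2 * Real.exp (-lam n * (T - t)) := by
      apply integral_mono_ae (hFi n).norm (hE.const_mul _)
      filter_upwards [hu] with t ht
      simp only [hF]
      have h2 := abs_mul_bval_le (abs_le.2 ht) n
      have e : ‖inner ℝ (cosBasis n) w * bval n * Real.exp (-lam n * (T - t)) * u t‖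
          = |inner ℝ (cosBasis n) w| * |u t * bval n| * Real.exp (-lam n * (T - t)) := by
        simp only [norm_mul, Real.norm_eq_abs, Real.abs_exp, abs_mul]
        ring
      rw [e]
      gcongr
    rw [integral_const_mul] at h1
    have h3 := integral_exp_mul_sub_le (lam_nonneg n) hT.le
    have hp := one_add_lam_pos n
    have h4 : ∫ t in Ioo (0 : ℝ) T, Real.exp (-lam n * (T - t)) ≤ (1 + T) / (1 + lam n) := by
      rw [le_div_iff₀ hp]
      linarith
    calc _ ≤ |inner ℝ (cosBasis n) w| * 2
          * ∫ t in Ioo (0 : ℝ) T, Real.exp (-lam n * (T - t)) := h1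
      _ ≤ |inner ℝ (cosBasis n) w| * 2 * ((1 + T) / (1 + lam n)) := by gcongr
      _ = |inner ℝ (cosBasis n) w| * (2 * (1 + T) / (1 + lam n)) := by ring
      _ ≤ _ := by
        rw [← sq_abs (inner ℝ (cosBasis n) w : ℝ)]
        nlinarith [sq_nonneg (|inner ℝ (cosBasis n) w| - 2 * (1 + T) / (1 + lam n)),
          sq_nonneg |inner ℝ (cosBasis n) w|, sq_nonneg (2 * (1 + T) / (1 + lam n))]
  have hm : AEStronglyMeasurable (fun t => ∑' n, F n t) (volume.restrict (Ioo (0 : ℝ) T)) := by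
    simp only [hFt]
    exact (((continuousOn_theta T w).mono fun t ht => ht.2).aestronglyMeasurable
      measurableSet_Ioo).mul hui.aestronglyMeasurable
  have h1 := integrable_tsum hFi hs hm
  have h2 := hasSum_integral_of_summable_integral_norm hFi hs
  simp only [hFt] at h1 h2
  refine ⟨h1, (cosBasis.hasSum_inner_mul_inner w yT).unique ?_⟩
  have hcoef : ∀ n, inner ℝ w (cosBasis n) * inner ℝ (cosBasis n) yT
      = ∫ t in Ioo (0 : ℝ) T, F n t := by
    intro n
    rw [h.inner_terminal hT hy, duhamel, add_zero, real_inner_comm, integral_Ioo_eq hT.le,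
      ← intervalIntegral.integral_const_mul, ← intervalIntegral.integral_const_mul]
    congr 1
    ext t
    have e : Real.exp (-lam n * (T - t))
        = Real.exp (-1 * lam n * T) * Real.exp (-(-1 * lam n) * t) := by
      rw [← Real.exp_add]
      ring_nf
    simp only [hF, e]
    ring
  simp only [hcoef]
  exact h2

/-- The functional `w ↦ theta T w t` is represented by an element of `L²(0,1)`. -/
lemma exists_kernel {T t : ℝ} (ht : t < T) :
    ∃ k : L2, (∀ n, inner ℝ (cosBasis n) k = bval n * Real.exp (-lam n * (T - t))) ∧
      ∀ w, theta T w t = inner ℝ w k := by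
  have hδ : 0 < T - t := by linarith
  obtain ⟨k, hk⟩ := exists_of_coef (a := fun n => bval n * Real.exp (-lam n * (T - t))) (by
    refine Summable.of_nonneg_of_le (fun n => sq_nonneg _) (fun n => ?_)
      ((summable_inv_one_add_lam.mul_left (1 + (T - t)⁻¹)).mul_left 4)
    have h1 := abs_bval_le n
    have h2 := exp_mul_sub_le_one (lam_nonneg n) ht.le
    have h3 := exp_neg_lam_mul_le hδ n
    have h4 := Real.exp_pos (-lam n * (T - t))
    have h5 : bval n ^ 2 ≤ 4 := by
      rw [← sq_abs]
      nlinarith [abs_nonneg (bval n)]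
    rw [mul_pow]
    refine mul_le_mul h5 ?_ (sq_nonneg _) (by norm_num)
    nlinarith)
  refine ⟨k, hk, fun w => ?_⟩
  rw [theta, ← (cosBasis.hasSum_inner_mul_inner w k).tsum_eq]
  congr 1
  ext n
  rw [hk, real_inner_comm w]
  ring

/-- Terminal values whose trace has a fixed sign near `T` form a set with empty interior. -/
lemma interior_sign_eq_empty {T a σ : ℝ} (ha : a < T) (hσ : σ * σ = 1) :
    interior {w : L2 | ∀ t ∈ Ioo a T, 0 ≤ σ * theta T w t} = ∅ := by
  by_contra hne
  obtain ⟨w₀, hw₀⟩ := nonempty_iff_ne_empty.2 hne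
  rw [mem_interior_iff_mem_nhds, Metric.mem_nhds_iff] at hw₀
  obtain ⟨r, hr, hball⟩ := hw₀
  obtain ⟨s, hs⟩ : ∃ s : Finset ℕ,
      dist (∑ n ∈ s, (inner ℝ (cosBasis n) w₀ : ℝ) • cosBasis n) w₀ < r / 2 := by
    have h := cosBasis.hasSum_repr w₀
    simp only [HilbertBasis.repr_apply_apply] at h
    exact ((Metric.tendsto_nhds.1 h) (r / 2) (by linarith)).exists
  set w₁ := ∑ n ∈ s, (inner ℝ (cosBasis n) w₀ : ℝ) • cosBasis n with hw₁
  set B := ∑ n ∈ s, |inner ℝ (cosBasis n) w₀| * 2 with hB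
  have hbound : ∀ t ∈ Ioo a T, ∀ k : L2,
      (∀ n, inner ℝ (cosBasis n) k = bval n * Real.exp (-lam n * (T - t))) →
      (∀ w, theta T w t = inner ℝ w k) → ‖k‖ ≤ 4 / r * B := by
    intro t ht k hk hθ
    -- Only finitely many modes of `w₁` are nonzero, so its trace is bounded independently of `t`;
    -- this is why `w₀` is replaced by a finite sum.
    have h1 : |inner ℝ w₁ k| ≤ B := by
      rw [hw₁, sum_inner]
      refine (Finset.abs_sum_le_sum_abs _ _).trans (Finset.sum_le_sum fun n _ => ?_)
      rw [real_inner_smul_left, hk, abs_mul, abs_mul, Real.abs_exp]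
      have h2 := exp_mul_sub_le_one (lam_nonneg n) ht.2.le
      have h3 := abs_bval_le n
      have h4 := Real.exp_pos (-lam n * (T - t))
      refine mul_le_mul_of_nonneg_left ?_ (abs_nonneg _)
      nlinarith [abs_nonneg (bval n)]
    -- An inequality suffices and covers `k = 0`, where the inverse norm is `0`.
    have hk1 : ‖‖k‖⁻¹ • k‖ ≤ 1 := by
      rw [norm_smul, norm_inv, norm_norm]
      exact inv_mul_le_one
    have hσ1 : |σ| = 1 := by
      rw [← abs_mul_abs_self] at hσ
      nlinarith [abs_nonneg σ]
    -- The step of length at most `r / 4` lowers the signed trace at `t` by `r / 4 * ‖k‖`. As `r / 2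
    -- + r / 4 < r`, the point stays in the ball, so the signed trace remains nonnegative and `‖k‖`
    -- is bounded.
    have hmem : w₁ + (-(σ * (r / 4))) • (‖k‖⁻¹ • k) ∈ Metric.ball w₀ r := by
      rw [Metric.mem_ball]
      have h2 : dist (w₁ + (-(σ * (r / 4))) • (‖k‖⁻¹ • k)) w₁ ≤ r / 4 := by
        rw [dist_eq_norm, add_sub_cancel_left, norm_smul, norm_neg, Real.norm_eq_abs, abs_mul,
          hσ1, one_mul, abs_of_pos (by linarith)]
        exact mul_le_of_le_one_right (by linarith) hk1
      linarith [dist_triangle (w₁ + (-(σ * (r / 4))) • (‖k‖⁻¹ • k)) w₁ w₀]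
    have h2 := hball hmem t ht
    rw [hθ, inner_add_left, real_inner_smul_left, real_inner_smul_left,
      real_inner_self_eq_norm_sq] at h2
    have h3 : ‖k‖⁻¹ * ‖k‖ ^ 2 = ‖k‖ := by
      rcases eq_or_ne ‖k‖ 0 with h | h
      · simp [h]
      · field_simp
    rw [h3] at h2
    have h4 : σ * inner ℝ w₁ k ≤ B := by
      refine (le_abs_self _).trans ?_
      rwa [abs_mul, hσ1, one_mul]
    have h5 : σ * (inner ℝ w₁ k + -(σ * (r / 4)) * ‖k‖)
        = σ * inner ℝ w₁ k - (σ * σ) * (r / 4 * ‖k‖) := by ring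
    rw [h5, hσ] at h2
    rw [div_mul_eq_mul_div, le_div_iff₀ hr]
    linarith
  -- As `t → T` each of the first `N` modes contributes at least `1` in the limit to the squared
  -- kernel norm, so no uniform bound can hold.
  have hN : ∀ N : ℕ, (N : ℝ) ≤ (4 / r * B) ^ 2 := by
    intro N
    have hlim : Tendsto (fun t => ∑ n ∈ Finset.range N, Real.exp (-lam n * (T - t)) ^ 2)
        (𝓝[<] T) (𝓝 N) := by
      have hc : Continuous fun t => ∑ n ∈ Finset.range N, Real.exp (-lam n * (T - t)) ^ 2 := by
        fun_prop
      have h := (hc.tendsto T).mono_left (nhdsWithin_le_nhds (s := Iio T))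
      simpa using h
    refine le_of_tendsto hlim ?_
    filter_upwards [Ioo_mem_nhdsLT ha] with t ht
    obtain ⟨k, hk, hθ⟩ := exists_kernel ht.2
    have h1 := hbound t ht k hk hθ
    have h2 := cosBasis.orthonormal.sum_inner_products_le k (s := Finset.range N)
    calc _ ≤ ∑ n ∈ Finset.range N, ‖inner ℝ (cosBasis n) k‖ ^ 2 := by
          refine Finset.sum_le_sum fun n _ => ?_
          rw [hk, norm_mul, Real.norm_eq_abs, Real.norm_eq_abs, Real.abs_exp, mul_pow, abs_bval]
          have h3 := one_le_kap n
          exact le_mul_of_one_le_left (sq_nonneg _) (one_le_pow₀ h3)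
      _ ≤ ‖k‖ ^ 2 := h2
      _ ≤ _ := pow_le_pow_left₀ (norm_nonneg _) h1 2
  obtain ⟨N, hN'⟩ := exists_nat_gt ((4 / r * B) ^ 2)
  linarith [hN N]

/-- For each fixed `t < T` the trace is a continuous functional of `w`, so each sign condition is
closed. -/
lemma isClosed_sign (T a σ : ℝ) :
    IsClosed {w : L2 | ∀ t ∈ Ioo a T, 0 ≤ σ * theta T w t} := by
  simp only [ofPred_forall]
  refine isClosed_iInter fun t => isClosed_iInter fun ht => ?_
  obtain ⟨k, -, hk⟩ := exists_kernel ht.2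
  simp only [hk]
  exact isClosed_le continuous_const (continuous_const.mul (continuous_id.inner continuous_const))

/-- There is a terminal value whose boundary trace oscillates around zero as `t → T`. -/
lemma exists_oscillating (T : ℝ) : ∃ w : L2, ∀ a < T,
    (∃ t ∈ Ioo a T, 0 < theta T w t) ∧ ∃ t ∈ Ioo a T, theta T w t < 0 := by
  by_contra! hcon
  let sg : Bool → ℝ := fun b => if b then 1 else -1
  have hsg : ∀ b, sg b * sg b = 1 := by
    intro b
    cases b <;> simp [sg]
  let A : ℕ × Bool → Set L2 := fun i =>
    {w : L2 | ∀ t ∈ Ioo (T - 1 / ((i.1 : ℝ) + 1)) T, 0 ≤ sg i.2 * theta T w t}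
  -- If no `w` oscillates, every trace is eventually nonnegative or nonpositive, and the countably
  -- many sets `A i` cover the space.
  obtain ⟨i, hi⟩ := nonempty_interior_of_iUnion_of_closed (f := A)
    (fun i => isClosed_sign _ _ _) (by
      rw [eq_univ_iff_forall]
      intro w
      obtain ⟨a, ha, h⟩ := hcon w
      obtain ⟨m, hm⟩ := exists_nat_one_div_lt (sub_pos.2 ha)
      rw [mem_iUnion]
      by_cases hp : ∃ t ∈ Ioo a T, 0 < theta T w t
      · refine ⟨(m, true), fun t ht => ?_⟩
        have := h hp t ⟨by linarith [ht.1], ht.2⟩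
        simpa [sg] using this
      · push Not at hp
        refine ⟨(m, false), fun t ht => ?_⟩
        have := hp t ⟨by linarith [ht.1], ht.2⟩
        simpa [sg] using this)
  have hlt : T - 1 / ((i.1 : ℝ) + 1) < T := by
    have : 0 < 1 / ((i.1 : ℝ) + 1) := by positivity
    linarith
  rw [interior_sign_eq_empty hlt (hsg i.2)] at hi
  exact not_nonempty_empty hi

/-! ### Switching functions of oscillating analytic functions -/

/-- `θ` takes both signs arbitrarily close to `T` from the left. -/
def Oscillates (T : ℝ) (θ : ℝ → ℝ) : Prop :=
  ∀ a < T, (∃ t ∈ Ioo a T, 0 < θ t) ∧ ∃ t ∈ Ioo a T, θ t < 0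

section Switching

variable {T : ℝ} {θ : ℝ → ℝ}

/-- Accumulating zeros would make `θ` vanish identically by the identity theorem, but oscillation
provides a positive value. -/
lemma not_frequently_eq_zero (hT : 0 < T) (hθ : AnalyticOnNhd ℝ θ (Ico 0 T))
    (ho : Oscillates T θ) {t : ℝ} (ht : t ∈ Ico 0 T) : ∀ᶠ s in 𝓝[≠] t, θ s ≠ 0 := by
  by_contra h
  obtain ⟨s, hs, hpos⟩ := (ho 0 hT).1
  have := hθ.eqOn_zero_of_preconnected_of_frequently_eq_zero isPreconnected_Ico ht
    (fun h' => h h') ⟨hs.1.le, hs.2⟩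
  rw [this] at hpos
  exact lt_irrefl _ hpos

lemma finite_zeros (hT : 0 < T) (hθ : AnalyticOnNhd ℝ θ (Ico 0 T)) (ho : Oscillates T θ) {ε : ℝ}
    (hε : 0 < ε) : (Icc 0 (T - ε) ∩ {t | θ t = 0}).Finite := by
  by_contra h
  obtain ⟨t, ht, hacc⟩ :=
    Set.Infinite.exists_accPt_of_subset_isCompact h isCompact_Icc inter_subset_left
  have h1 := accPt_iff_frequently_nhdsNE.1 hacc
  have h2 := not_frequently_eq_zero hT hθ ho (t := t) ⟨ht.1, by linarith [ht.2]⟩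
  obtain ⟨s, hs1, hs2⟩ := (h1.and_eventually h2).exists
  exact hs2 hs1.2

lemma ae_ne_zero (hT : 0 < T) (hθ : AnalyticOnNhd ℝ θ (Ico 0 T)) (ho : Oscillates T θ) :
    ∀ᵐ t ∂(volume.restrict (Ioo (0 : ℝ) T)), θ t ≠ 0 := by
  have hcount : (⋃ m : ℕ, Icc 0 (T - 1 / ((m : ℝ) + 1)) ∩ {t | θ t = 0}).Countable :=
    countable_iUnion fun m => (finite_zeros hT hθ ho (by positivity)).countable
  rw [ae_restrict_iff' measurableSet_Ioo]
  filter_upwards [compl_mem_ae_iff.2 (hcount.measure_zero volume)] with t ht htm h0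
  obtain ⟨m, hm⟩ := exists_nat_one_div_lt (sub_pos.2 htm.2)
  exact ht (mem_iUnion.2 ⟨m, ⟨htm.1.le, by linarith⟩, h0⟩)

/-- Isolated zeros leave a zero-free interval to the right of `t`, on which continuity fixes the
sign. This holds at zeros of `θ` too and is what makes a right-continuous representative possible.
-/
lemma exists_right_sign (hT : 0 < T) (hθ : AnalyticOnNhd ℝ θ (Ico 0 T)) (ho : Oscillates T θ)
    {t : ℝ} (ht : t ∈ Ico 0 T) :
    ∃ δ > 0, (∀ s ∈ Ioo t (t + δ), 0 < θ s) ∨ ∀ s ∈ Ioo t (t + δ), θ s < 0 := by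
  have h1 := not_frequently_eq_zero hT hθ ho ht
  rw [eventually_nhdsWithin_iff, Metric.eventually_nhds_iff] at h1
  obtain ⟨r, hr, h1⟩ := h1
  refine ⟨min r (T - t), lt_min hr (by linarith [ht.2]), ?_⟩
  have hsub : Ioo t (t + min r (T - t)) ⊆ Ico 0 T := fun s hs =>
    ⟨ht.1.trans hs.1.le, by linarith [hs.2, min_le_right r (T - t)]⟩
  have hne : ∀ s ∈ Ioo t (t + min r (T - t)), θ s ≠ 0 := by
    intro s hs
    refine h1 ?_ hs.1.ne'
    rw [Real.dist_eq, abs_of_pos (by linarith [hs.1])]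
    linarith [hs.2, min_le_left r (T - t)]
  by_contra! hcon
  obtain ⟨⟨a, ha, ha0⟩, b, hb, hb0⟩ := hcon
  obtain ⟨s, hs, hs0⟩ := isPreconnected_Ioo.intermediate_value ha hb
    (hθ.continuousOn.mono hsub) ⟨ha0, hb0⟩
  exact hne s hs hs0

open Classical in
/-- The right-continuous representative of `-sgn θ`. -/
def switching (θ : ℝ → ℝ) (t : ℝ) : ℝ :=
  if ∃ δ > 0, ∀ s ∈ Ioo t (t + δ), 0 < θ s then -1 else 1

lemma switching_eq (θ : ℝ → ℝ) (t : ℝ) : switching θ t = -1 ∨ switching θ t = 1 := by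
  unfold switching
  split_ifs <;> simp

lemma switching_of_pos {t δ : ℝ} (h : ∀ s ∈ Ioo t (t + δ), 0 < θ s) {s : ℝ}
    (hs : s ∈ Ico t (t + δ)) : switching θ s = -1 :=
  if_pos ⟨t + δ - s, by linarith [hs.2], fun r hr => h r ⟨hs.1.trans_lt hr.1, by linarith [hr.2]⟩⟩

lemma switching_of_neg {t δ : ℝ} (h : ∀ s ∈ Ioo t (t + δ), θ s < 0) {s : ℝ}
    (hs : s ∈ Ico t (t + δ)) : switching θ s = 1 := by
  refine if_neg ?_
  rintro ⟨δ', hδ', h'⟩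
  obtain ⟨r, hr1, hr2⟩ := exists_between (lt_min (show s < s + δ' by linarith) hs.2)
  exact lt_asymm (h' r ⟨hr1, hr2.trans_le (min_le_left _ _)⟩)
    (h r ⟨hs.1.trans_lt hr1, hr2.trans_le (min_le_right _ _)⟩)

lemma continuousWithinAt_switching (hT : 0 < T) (hθ : AnalyticOnNhd ℝ θ (Ico 0 T))
    (ho : Oscillates T θ) {t : ℝ} (ht : t ∈ Ico 0 T) :
    ContinuousWithinAt (switching θ) (Ici t) t := by
  obtain ⟨δ, hδ, h⟩ := exists_right_sign hT hθ ho ht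
  have hmem : Ico t (t + δ) ∈ 𝓝[≥] t := Ico_mem_nhdsGE (by linarith)
  have ht' : t ∈ Ico t (t + δ) := ⟨le_rfl, by linarith⟩
  have he : switching θ =ᶠ[𝓝[≥] t] fun _ => switching θ t := by
    filter_upwards [hmem] with s hs
    rcases h with h | h
    · rw [switching_of_pos h hs, switching_of_pos h ht']
    · rw [switching_of_neg h hs, switching_of_neg h ht']
  exact continuousWithinAt_const.congr_of_eventuallyEq he rfl

lemma switching_eq_of_pos {t : ℝ} (hc : ContinuousAt θ t) (h : 0 < θ t) : switching θ t = -1 := by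
  obtain ⟨δ, hδ, hb⟩ := Metric.eventually_nhds_iff.1 (hc.eventually (lt_mem_nhds h))
  refine switching_of_pos (t := t) (δ := δ) (fun s hs => hb ?_) ⟨le_rfl, by linarith⟩
  rw [Real.dist_eq, abs_of_pos (by linarith [hs.1])]
  linarith [hs.2]

lemma switching_eq_of_neg {t : ℝ} (hc : ContinuousAt θ t) (h : θ t < 0) : switching θ t = 1 := by
  obtain ⟨δ, hδ, hb⟩ := Metric.eventually_nhds_iff.1 (hc.eventually (gt_mem_nhds h))
  refine switching_of_neg (t := t) (δ := δ) (fun s hs => hb ?_) ⟨le_rfl, by linarith⟩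
  rw [Real.dist_eq, abs_of_pos (by linarith [hs.1])]
  linarith [hs.2]

lemma switching_eq_neg_sign {t : ℝ} (hc : ContinuousAt θ t) (h : θ t ≠ 0) :
    switching θ t = -Real.sign (θ t) := by
  rcases lt_or_gt_of_ne h with h | h
  · rw [switching_eq_of_neg hc h, Real.sign_of_neg h, neg_neg]
  · rw [switching_eq_of_pos hc h, Real.sign_of_pos h]

lemma continuousAt_switching (hθ : AnalyticOnNhd ℝ θ (Ico 0 T)) {t : ℝ} (ht : t ∈ Ioo 0 T)
    (h : θ t ≠ 0) : ContinuousAt (switching θ) t := by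
  have hc : ∀ s ∈ Ioo 0 T, ContinuousAt θ s := fun s hs =>
    (hθ s (Ioo_subset_Ico_self hs)).continuousAt
  have hT : ∀ᶠ s in 𝓝 t, s ∈ Ioo 0 T := isOpen_Ioo.mem_nhds ht
  have he : switching θ =ᶠ[𝓝 t] fun _ => switching θ t := by
    rcases lt_or_gt_of_ne h with h | h
    · filter_upwards [hT, (hc t ht).eventually (gt_mem_nhds h)] with s hs h1
      rw [switching_eq_of_neg (hc s hs) h1, switching_eq_of_neg (hc t ht) h]
    · filter_upwards [hT, (hc t ht).eventually (lt_mem_nhds h)] with s hs h1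
      rw [switching_eq_of_pos (hc s hs) h1, switching_eq_of_pos (hc t ht) h]
  exact continuousAt_const.congr he.symm

lemma finite_switchingPoints (hT : 0 < T) (hθ : AnalyticOnNhd ℝ θ (Ico 0 T))
    (ho : Oscillates T θ) {ε : ℝ} (hε : 0 < ε) :
    (switchingPoints T (switching θ) ∩ Icc 0 (T - ε)).Finite := by
  refine (finite_zeros hT hθ ho hε).subset ?_
  rintro t ⟨ht, htε⟩
  refine ⟨htε, ?_⟩
  by_contra h
  exact ht.2 (continuousAt_switching hθ ht.1 h)

/-! ### Infinitely many sign changes and switches. -/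

lemma Oscillates.exists_seq (hT : 0 < T) (ho : Oscillates T θ) :
    ∃ s : ℕ → ℝ, StrictMono s ∧ (∀ k, s k ∈ Ioo 0 T) ∧
      ∀ k, 0 < θ (s (2 * k)) ∧ θ (s (2 * k + 1)) < 0 := by
  have hf : ∀ a, ∃ t, a < T → t ∈ Ioo a T ∧ 0 < θ t := by
    intro a
    by_cases h : a < T
    · obtain ⟨t, h1, h2⟩ := (ho a h).1
      exact ⟨t, fun _ => ⟨h1, h2⟩⟩
    · exact ⟨0, fun h' => absurd h' h⟩
  have hg : ∀ a, ∃ t, a < T → t ∈ Ioo a T ∧ θ t < 0 := by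
    intro a
    by_cases h : a < T
    · obtain ⟨t, h1, h2⟩ := (ho a h).2
      exact ⟨t, fun _ => ⟨h1, h2⟩⟩
    · exact ⟨0, fun h' => absurd h' h⟩
  choose f hf using hf
  choose g hg using hg
  -- Starting from a positive value, each further point is chosen to the right of the previous one
  -- with the opposite sign.
  let s : ℕ → ℝ := fun n => Nat.rec (f 0) (fun n x => if Even n then g x else f x) n
  have hs0 : s 0 = f 0 := rfl
  have hs1 : ∀ n, s (n + 1) = if Even n then g (s n) else f (s n) := fun n => rfl
  have hmem : ∀ n, s n ∈ Ioo 0 T := by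
    intro n
    induction n with
    | zero => exact (hf 0 hT).1
    | succ n ih =>
      rw [hs1]
      split_ifs
      · exact ⟨ih.1.trans (hg _ ih.2).1.1, (hg _ ih.2).1.2⟩
      · exact ⟨ih.1.trans (hf _ ih.2).1.1, (hf _ ih.2).1.2⟩
  refine ⟨s, strictMono_nat_of_lt_succ fun n => ?_, hmem, fun k => ⟨?_, ?_⟩⟩
  · rw [hs1]
    split_ifs
    · exact (hg _ (hmem n).2).1.1
    · exact (hf _ (hmem n).2).1.1
  · rcases k with _ | k
    · exact (hf 0 hT).2
    · have e : 2 * (k + 1) = (2 * k + 1) + 1 := by ring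
      rw [e, hs1, if_neg (by simp)]
      exact (hf _ (hmem (2 * k + 1)).2).2
  · rw [hs1, if_pos (by simp)]
    exact (hg _ (hmem _).2).2

/-- Between a positive and the following negative value of `θ` the switching function passes from
`-1` to `1`. If it were continuous there, it would take the value `0`. -/
lemma infinite_switchingPoints (hT : 0 < T) (hθ : AnalyticOnNhd ℝ θ (Ico 0 T))
    (ho : Oscillates T θ) : (switchingPoints T (switching θ)).Infinite := by
  obtain ⟨s, hs, hmem, hsign⟩ := ho.exists_seq hT
  have hc : ∀ n, ContinuousAt θ (s n) := fun n =>
    (hθ _ (Ioo_subset_Ico_self (hmem n))).continuousAt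
  have hex : ∀ k, ∃ x ∈ Icc (s (2 * k)) (s (2 * k + 1)), x ∈ switchingPoints T (switching θ) := by
    intro k
    by_contra! hcon
    have hcont : ContinuousOn (switching θ) (Icc (s (2 * k)) (s (2 * k + 1))) := by
      intro x hx
      have h1 := hcon x hx
      have h2 : x ∈ Ioo 0 T := ⟨(hmem _).1.trans_le hx.1, hx.2.trans_lt (hmem _).2⟩
      by_contra h3
      exact h1 ⟨h2, fun h4 => h3 h4.continuousWithinAt⟩
    have hle : s (2 * k) ≤ s (2 * k + 1) := (hs (Nat.lt_succ_self _)).le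
    obtain ⟨x, -, hx⟩ := isPreconnected_Icc.intermediate_value (left_mem_Icc.2 hle)
      (right_mem_Icc.2 hle) hcont (show (0 : ℝ) ∈ _ by
        rw [switching_eq_of_pos (hc _) (hsign k).1, switching_eq_of_neg (hc _) (hsign k).2]
        constructor <;> norm_num)
    rcases switching_eq θ x with h | h <;> rw [h] at hx <;> norm_num at hx
  choose x hx hxs using hex
  -- The intervals from even to odd indices are pairwise disjoint, so the points found in them are
  -- distinct.
  have hxm : StrictMono x := strictMono_nat_of_lt_succ fun k =>
    (hx k).2.trans_lt ((hs (by omega : 2 * k + 1 < 2 * (k + 1))).trans_le (hx (k + 1)).1)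
  exact infinite_of_injective_forall_mem hxm.injective hxs

end Switching

/-! ### Bang-bang controls -/

lemma measurable_sign : Measurable Real.sign := by
  unfold Real.sign
  exact Measurable.ite measurableSet_Iio measurable_const
    (Measurable.ite measurableSet_Ioi measurable_const measurable_const)

lemma abs_sign_le (r : ℝ) : |Real.sign r| ≤ 1 := by
  rcases Real.sign_apply_eq r with h | h | h <;> rw [h] <;> norm_num

/-- The bang-bang control `-sgn θ`. -/
lemma exists_bangBang {T : ℝ} {θ : ℝ → ℝ} (hθ : ContinuousOn θ (Ioo 0 T)) :
    ∃ u : L2T T ℝ, AdmissibleControl T u ∧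
      ∀ᵐ t ∂(volume.restrict (Ioo (0 : ℝ) T)), u t = - Real.sign (θ t) := by
  have hm : MemLp (fun t => - Real.sign (θ t)) 2 (volume.restrict (Ioo (0 : ℝ) T)) := by
    refine MemLp.of_bound ?_ 1 (ae_of_all _ fun t => ?_)
    · exact (measurable_sign.comp_aemeasurable
        (hθ.aemeasurable measurableSet_Ioo)).neg.aestronglyMeasurable
    · rw [norm_neg]
      exact abs_sign_le _
  refine ⟨hm.toLp _, ?_, hm.coeFn_toLp⟩
  filter_upwards [hm.coeFn_toLp] with t ht
  rw [ht, ← abs_le, abs_neg]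
  exact abs_sign_le _

/-- This is the pointwise minimum principle: `-sgn r` minimizes `r * v` over `[-1,1]`. -/
lemma sign_mul_nonneg {r v : ℝ} (hv : -1 ≤ v ∧ v ≤ 1) : 0 ≤ r * (v - -Real.sign r) := by
  rcases lt_trichotomy r 0 with h | rfl | h
  · rw [Real.sign_of_neg h]
    nlinarith [hv.2]
  · simp
  · rw [Real.sign_of_pos h]
    nlinarith [hv.1]

/-- First order optimality of the bang-bang control, with the case of equality. -/
lemma inner_sub_nonneg {T : ℝ} (hT : 0 < T) {w : L2} {u v : L2T T ℝ} {y z : L2T T H1} {yT zT : L2}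
    (hθ0 : ∀ᵐ t ∂(volume.restrict (Ioo (0 : ℝ) T)), theta T w t ≠ 0)
    (hu : AdmissibleControl T u)
    (hus : ∀ᵐ t ∂(volume.restrict (Ioo (0 : ℝ) T)), u t = - Real.sign (theta T w t))
    (hy : IsState T u y) (hyT : HasTimeTrace T y T yT) (hv : AdmissibleControl T v)
    (hz : IsState T v z) (hzT : HasTimeTrace T z T zT) :
    0 ≤ inner ℝ w (zT - yT) ∧ (inner ℝ w (zT - yT) ≤ (0 : ℝ) → v = u) := by
  obtain ⟨i1, e1⟩ := inner_terminal_eq hT w hu hy hyT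
  obtain ⟨i2, e2⟩ := inner_terminal_eq hT w hv hz hzT
  have e : inner ℝ w (zT - yT) = ∫ t in Ioo (0 : ℝ) T, theta T w t * (v t - u t) := by
    rw [inner_sub_right, e1, e2, ← integral_sub i2 i1]
    simp only [mul_sub]
  have hi : IntegrableOn (fun t => theta T w t * (v t - u t)) (Ioo 0 T) := by
    simp only [mul_sub]
    exact i2.sub i1
  have hnn : 0 ≤ᵐ[volume.restrict (Ioo (0 : ℝ) T)] fun t => theta T w t * (v t - u t) := by
    filter_upwards [hus, hv] with t h1 h2
    rw [h1]
    exact sign_mul_nonneg h2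
  rw [e]
  refine ⟨integral_nonneg_of_ae hnn, fun hle => ?_⟩
  have h0 := (integral_eq_zero_iff_of_nonneg_ae hnn hi).1
    (le_antisymm hle (integral_nonneg_of_ae hnn))
  apply Lp.ext
  filter_upwards [h0, hθ0] with t h1 h2
  exact sub_eq_zero.1 ((mul_eq_zero.1 h1).resolve_left h2)

end

end HeatControl

open HeatControl
-- The desired state fitted to an oscillating adjoint.
theorem theorem4p4 (T : ℝ) (hT : 0 < T) :
    ∃ yd : L2,
      -- the optimal objective function value is positive
      0 < optimalValue T yd ∧
      ∃ (u : L2T T ℝ) (y : L2T T H1) (yT : L2) (p : L2T T H1) (θ U : ℝ → ℝ),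
        -- `u` is the unique optimal control, `y` its state, `p` its adjoint state
        IsOptimal T yd u y yT ∧
        (∀ u' y' yT', IsOptimal T yd u' y' yT' → u' = u ∧ y' = y ∧ yT' = yT) ∧
        IsAdjointState T (yT - yd) p ∧
        (∀ p', IsAdjointState T (yT - yd) p' → p' = p) ∧
        -- `θ` is the analytic trace `p(·,1)` on `[0,T)`
        AnalyticOnNhd ℝ θ (Ico 0 T) ∧
        (∀ᵐ t ∂(volume.restrict (Ioo (0 : ℝ) T)), traceOne (p t) = θ t) ∧
        ChangesSignInfinitelyOften T θ ∧
        -- `U` is the right-continuous representative of `u` on `[0,T)`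
        (∀ᵐ t ∂(volume.restrict (Ioo (0 : ℝ) T)), u t = U t) ∧
        (∀ᵐ t ∂(volume.restrict (Ioo (0 : ℝ) T)), U t = - Real.sign (θ t)) ∧
        (∀ t ∈ Ico 0 T, ContinuousWithinAt U (Ici t) t) ∧
        (∀ t ∈ Ico 0 T, U t = -1 ∨ U t = 1) ∧
        (∀ ε > 0, (switchingPoints T U ∩ Icc 0 (T - ε)).Finite) ∧
        (switchingPoints T U).Infinite := by
  obtain ⟨w, ho⟩ := exists_oscillating T
  change Oscillates T (theta T w) at ho
  have hθ : AnalyticOnNhd ℝ (theta T w) (Ico 0 T) :=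
    (analyticOnNhd_theta T w).mono fun t ht => ht.2
  have hθ0 := ae_ne_zero hT hθ ho
  -- The zero terminal value has zero trace, which does not oscillate. The optimal value will be
  -- `‖w‖² / 2`, hence positive.
  have hw : 0 < ‖w‖ := by
    rw [norm_pos_iff]
    rintro rfl
    obtain ⟨t, -, ht⟩ := (ho 0 hT).1
    simp [theta] at ht
  obtain ⟨u, hu, hus⟩ := exists_bangBang (hθ.continuousOn.mono Ioo_subset_Ico_self)
  obtain ⟨y, yT, hy, hyT⟩ := exists_state hT hu
  obtain ⟨p, hp, hpθ⟩ := exists_adjoint hT w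
  have hsub : yT - (yT - w) = w := sub_sub_cancel _ _
  have hexp : ∀ zT : L2, ‖zT - (yT - w)‖ ^ 2
      = ‖w‖ ^ 2 + 2 * inner ℝ w (zT - yT) + ‖zT - yT‖ ^ 2 := by
    intro zT
    rw [← norm_add_sq_real]
    congr 2
    abel
  have hmin : ∀ j ∈ objectiveValues T (yT - w), 1 / 2 * ‖w‖ ^ 2 ≤ j := by
    rintro j ⟨v, z, zT, hv, hz, hzT, rfl⟩
    have h := (inner_sub_nonneg hT hθ0 hu hus hy hyT hv hz hzT).1
    rw [hexp]
    nlinarith [sq_nonneg ‖zT - yT‖]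
  have hmem : 1 / 2 * ‖w‖ ^ 2 ∈ objectiveValues T (yT - w) :=
    ⟨u, y, yT, hu, hy, hyT, by rw [hsub]⟩
  have hUs : ∀ᵐ t ∂(volume.restrict (Ioo (0 : ℝ) T)),
      switching (theta T w) t = - Real.sign (theta T w t) := by
    filter_upwards [hθ0, ae_restrict_mem measurableSet_Ioo] with t h1 h2
    exact switching_eq_neg_sign (hθ t (Ioo_subset_Ico_self h2)).continuousAt h1
  refine ⟨yT - w, lt_of_lt_of_le (by positivity) (le_csInf ⟨_, hmem⟩ hmin), u, y, yT, p, theta T w,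
    switching (theta T w), ⟨hu, hy, hyT, by rwa [hsub]⟩, ?_, by rwa [hsub], ?_, hθ, hpθ, ?_, ?_, hUs,
    fun t ht => continuousWithinAt_switching hT hθ ho ht, fun t _ => switching_eq _ t,
    fun ε hε => finite_switchingPoints hT hθ ho hε, infinite_switchingPoints hT hθ ho⟩
  · intro v z zT h
    have h1 := h.minimal _ hmem
    rw [hexp] at h1
    obtain ⟨-, h2⟩ :=
      inner_sub_nonneg hT hθ0 hu hus hy hyT h.admissible h.state h.terminal
    -- Optimality bounds the expanded objective by `‖w‖² / 2`, so the linear term is nonpositive,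
    -- which is the equality case of the first order condition.
    obtain rfl : v = u := h2 (by nlinarith [sq_nonneg ‖zT - yT‖])
    obtain rfl := h.state.unique hT hy
    exact ⟨rfl, rfl, h.terminal.unique hT (right_mem_Icc.2 hT.le) hyT⟩
  · intro q hq
    rw [hsub] at hq
    exact hq.unique hT hp
  · obtain ⟨s, h1, h2, h3⟩ := ho.exists_seq hT
    exact ⟨s, h1, fun k => Ioo_subset_Ico_self (h2 k), h3⟩
  · filter_upwards [hus, hUs] with t h1 h2
    rw [h1, h2]
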